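/- Let $\mathbb{U}$ be a compact Lie group, $\Bbbk\in\{\mathbb{R},\mathbb{C}\}$, and $X$ a Tychonoff space with a continuous $\mathbb{U}$-action. Let $\pi:\mathcal{E}\to X$ be a continuous (that is, (F)) $\mathbb{U}$-equivariant Banach bundle over $\Bbbk$: $\pi$ is a continuous open surjection whose fibers $\mathcal{E}_x$ are Banach spaces; addition, scaling and the norm are continuous on the total space; for every $x\in X$ the sets $\{v\in\pi^{-1}(W) : \|v\|<\varepsilon\}$, with $W\ni x$ open and $\varepsilon>0$, form a neighborhood basis at $0\in\mathcal{E}_x$; and $\mathbb{U}$ acts continuously and fiberwise linearly on $\mathcal{E}$, with $\pi$ equivariant. Assume that $\mathcal{E}$ is subhomogeneous (its fibers are finite-dimensional, of uniformly bounded dimension). Let $F\subseteq X$ be a closed $\mathbb{U}$-invariant subset such that - $\mathcal{E}_x=\{0\}$ for all $x\in F$; - the open subset $X\setminus F$ is a normal ($T_4$) space; - $\mathcal{E}$ is homogeneous over $X\setminus F$ (its fibers there all have the same finite dimension) and of finite type there: $X\setminus F$ is a finite union of $\mathbb{U}$-invariant open subsets over each of which $\mathcal{E}$ is equivariantly trivial.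 Here a bundle is *equivariantly trivial* over an invariant open set $W$ if its restriction to $W$ is isomorphic, by an equivariant fiberwise linear homeomorphism over $W$, to the pullback of a local object $\mathbb{U}\times_{\mathbb{K}}V\to\mathbb{U}/\mathbb{K}$ along a continuous equivariant map $W\to\mathbb{U}/\mathbb{K}$, for some closed subgroup $\mathbb{K}\le\mathbb{U}$ and some finite-dimensional continuous $\mathbb{K}$-representation $V$ over $\Bbbk$; a $\mathbb{U}$-equivariant vector bundle is *locally trivial* if $X$ is covered by invariant open sets over which it is equivariantly trivial. Then $\mathcal{E}$ embeds into a locally trivial $\mathbb{U}$-equivariant vector bundle over $X$: there are such a bundle $\mathcal{V}\to X$ and a $\mathbb{U}$-equivariant map $\mathcal{E}\to\mathcal{V}$ over $X$ which is linear on fibers and a homeomorphism onto its image. -/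

import Mathlib

open Bundle Topology
open scoped Manifold ContDiff

universe w

namespace EqBundle

/-! ## Families of vector spaces with a topology on the total space -/

/-- The total space of a family `E` over `X`; its points are pairs `⟨x, v⟩` with `v : E x`. The
topology is always given as data (the `Unit` argument is a dummy model fibre). -/
abbrev Tot {X : Type*} (E : X → Type*) := TotalSpace Unit E

/-- The point `v ∈ E x` of the total space. -/
abbrev Tot.mk {X : Type*} {E : X → Type*} (x : X) (v : E x) : Tot E := TotalSpace.mk x v

/-- Invariance of a subset of a `G`-set. -/
def Invariant (G : Type*) {X : Type*} [Group G] [MulAction G X] (S : Set X) : Prop :=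
  ∀ g : G, ∀ x ∈ S, g • x ∈ S

/-- A `G`-equivariant bundle of topological vector spaces: the projection, the fibrewise addition
(on the fibre product `E ×_X E`), the scaling and the action are continuous; the action covers the
one on `X` and is fibrewise linear. -/
structure IsLinearBundle (𝕜 G : Type*) {X : Type*} [RCLike 𝕜] [Group G] [TopologicalSpace G]
    [TopologicalSpace X] [MulAction G X] (E : X → Type*) [∀ x, AddCommGroup (E x)]
    [∀ x, Module 𝕜 (E x)] [TopologicalSpace (Tot E)] [MulAction G (Tot E)] : Prop where
  continuous_proj : Continuous fun e : Tot E => e.proj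
  continuous_add :
    Continuous fun p : TotalSpace (Unit × Unit) (E ×ᵇ E) => Tot.mk p.proj (p.snd.1 + p.snd.2)
  continuous_scale : Continuous fun p : 𝕜 × Tot E => Tot.mk p.2.proj (p.1 • p.2.snd)
  continuous_act : Continuous fun p : G × Tot E => p.1 • p.2
  act_linear : ∀ (g : G) (x : X), ∃ L : E x →ₗ[𝕜] E (g • x),
    ∀ v : E x, g • Tot.mk x v = Tot.mk (g • x) (L v)

/-- A continuous (i.e. (F)) `G`-equivariant Banach bundle. No isometry of the action is required. -/
structure IsContinuousBanachBundle (𝕜 G : Type*) {X : Type*} [RCLike 𝕜] [Group G]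
    [TopologicalSpace G] [TopologicalSpace X] [MulAction G X] (E : X → Type*)
    [∀ x, NormedAddCommGroup (E x)] [∀ x, NormedSpace 𝕜 (E x)] [TopologicalSpace (Tot E)]
    [MulAction G (Tot E)] : Prop extends IsLinearBundle 𝕜 G E where
  complete : ∀ x, CompleteSpace (E x)
  isOpenMap_proj : IsOpenMap fun e : Tot E => e.proj
  continuous_norm : Continuous fun e : Tot E => ‖e.snd‖
  nhds_zero : ∀ x : X, (𝓝 (Tot.mk x (0 : E x))).HasBasis
    (fun p : Set X × ℝ => IsOpen p.1 ∧ x ∈ p.1 ∧ 0 < p.2)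
    (fun p => {e : Tot E | e.proj ∈ p.1 ∧ ‖e.snd‖ < p.2})

/-- All fibres are finite-dimensional, of uniformly bounded dimension. -/
def IsSubhomogeneous (𝕜 : Type*) {X : Type*} [RCLike 𝕜] (E : X → Type*)
    [∀ x, AddCommGroup (E x)] [∀ x, Module 𝕜 (E x)] : Prop :=
  ∃ N : ℕ, ∀ x, FiniteDimensional 𝕜 (E x) ∧ Module.finrank 𝕜 (E x) ≤ N

/-- The fibres over `S` are finite-dimensional, of one and the same dimension. -/
def IsHomogeneousOver (𝕜 : Type*) {X : Type*} [RCLike 𝕜] (E : X → Type*)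
    [∀ x, AddCommGroup (E x)] [∀ x, Module 𝕜 (E x)] (S : Set X) : Prop :=
  ∃ n : ℕ, ∀ x ∈ S, FiniteDimensional 𝕜 (E x) ∧ Module.finrank 𝕜 (E x) = n

/-! ## Local objects `G ×_K V → G ⧸ K` and local triviality -/

section LocalObjects

variable {𝕜 G : Type*} [RCLike 𝕜] [Group G]

/-- The relation `(g k, v) ∼ (g, k v)`, `k ∈ K`, on `G × V`, for a representation `ρ` of the
subgroup `K` on `V = 𝕜ⁿ`. -/
def balanced (K : Subgroup G) {n : ℕ} (ρ : Representation 𝕜 K (Fin n → 𝕜)) :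
    Setoid (G × (Fin n → 𝕜)) where
  r p q := ∃ k : K, q.1 = p.1 * k ∧ p.2 = ρ k q.2
  iseqv :=
    { refl := fun p => ⟨1, by simp, by simp⟩
      symm := by
        rintro ⟨g, v⟩ ⟨g', v'⟩ ⟨k, h1, h2⟩
        refine ⟨k⁻¹, ?_, ?_⟩
        · simp only at h1
          simp [h1]
        · simp only at h2
          simp [h2]
      trans := by
        rintro ⟨g, v⟩ ⟨g', v'⟩ ⟨g'', v''⟩ ⟨k, h1, h2⟩ ⟨l, h3, h4⟩
        refine ⟨k * l, ?_, ?_⟩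
        · simp only at h1 h3
          simp [h1, h3, mul_assoc]
        · simp only at h2 h4
          simp [h2, h4] }

/-- The total space of `G ×_K V → G ⧸ K`. -/
def LocalObject (K : Subgroup G) {n : ℕ} (ρ : Representation 𝕜 K (Fin n → 𝕜)) :=
  Quotient (balanced K ρ)

namespace LocalObject

variable {K : Subgroup G} {n : ℕ} {ρ : Representation 𝕜 K (Fin n → 𝕜)}

/-- The quotient topology. -/
instance [TopologicalSpace G] : TopologicalSpace (LocalObject K ρ) :=
  inferInstanceAs (TopologicalSpace (Quotient (balanced K ρ)))

/-- The class of `(g, v)`. The fibre over `g K` is `{mk ρ g v | v}`, with the linear structure for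
which `v ↦ mk ρ g v` is linear. -/
def mk (ρ : Representation 𝕜 K (Fin n → 𝕜)) (g : G) (v : Fin n → 𝕜) : LocalObject K ρ :=
  Quotient.mk (balanced K ρ) (g, v)

/-- The left translation action `h [g, v] = [h g, v]`. -/
instance : SMul G (LocalObject K ρ) where
  smul h := Quotient.map (fun p => (h * p.1, p.2)) (by
    rintro ⟨g, v⟩ ⟨g', v'⟩ ⟨k, h1, h2⟩
    refine ⟨k, ?_, h2⟩
    simp only at h1
    simp [h1, mul_assoc])

end LocalObject

end LocalObjects

section LocalTriviality

variable (𝕜 G : Type*) {X : Type*} [RCLike 𝕜] [Group G] [TopologicalSpace G]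
  [TopologicalSpace X] [MulAction G X] (E : X → Type*) [∀ x, AddCommGroup (E x)]
  [∀ x, Module 𝕜 (E x)] [TopologicalSpace (Tot E)] [MulAction G (Tot E)]

/-- `E` is equivariantly trivial over the invariant open set `U`: there are a closed subgroup `K`, a
(continuous, finite-dimensional) representation `ρ` of `K` and an equivariant bundle map `Φ`
from `E|_U` to the local object `G ×_K V`, linear and bijective on each fibre, over a continuous
map `f : U → G ⧸ K`, which identifies `E|_U` with the pullback of `G ×_K V` along `f`, that is,
`e ↦ (π e, Φ e)` is a homeomorphism onto its image. Values of `f` and `Φ` off `U` are irrelevant. -/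
def IsTrivialOver (U : Set X) : Prop :=
  IsOpen U ∧ Invariant G U ∧
  ∃ (K : Subgroup G) (n : ℕ) (ρ : Representation 𝕜 K (Fin n → 𝕜))
    (f : X → G ⧸ K) (Φ : Tot E → LocalObject K ρ),
    IsClosed (K : Set G) ∧
    (Continuous fun p : K × (Fin n → 𝕜) => ρ p.1 p.2) ∧
    ContinuousOn f U ∧
    (∀ x ∈ U, ∃ (g : G) (L : E x ≃ₗ[𝕜] (Fin n → 𝕜)),
      f x = (g : G ⧸ K) ∧ ∀ v : E x, Φ (Tot.mk x v) = LocalObject.mk ρ g (L v)) ∧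
    (∀ (g : G) (e : Tot E), e.proj ∈ U → Φ (g • e) = g • Φ e) ∧
    IsEmbedding (fun e : {e : Tot E // e.proj ∈ U} => (e.1.proj, Φ e.1))

/-- `E` is of finite type over `S`: `S` has a finite cover by invariant open sets over which `E` is
equivariantly trivial. -/
def IsFiniteTypeOver (S : Set X) : Prop :=
  ∃ (m : ℕ) (U : Fin m → Set X), (⋃ i, U i) = S ∧ ∀ i, IsTrivialOver 𝕜 G E (U i)

/-- A locally trivial `G`-equivariant vector bundle (of finite rank, as local objects are). -/
def IsLocallyTrivialVectorBundle : Prop :=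
  IsLinearBundle 𝕜 G E ∧ ∀ x : X, ∃ U : Set X, x ∈ U ∧ IsTrivialOver 𝕜 G E U

end LocalTriviality

/-- The fibrewise linear maps `φ x : E x → V x` form an embedding of `G`-equivariant bundles: the
induced map of total spaces is equivariant and a homeomorphism onto its image. -/
def IsBundleEmbedding (𝕜 G : Type*) {X : Type*} [RCLike 𝕜] [Group G]
    (E : X → Type*) [∀ x, AddCommGroup (E x)] [∀ x, Module 𝕜 (E x)]
    [TopologicalSpace (Tot E)] [MulAction G (Tot E)]
    (V : X → Type*) [∀ x, AddCommGroup (V x)] [∀ x, Module 𝕜 (V x)]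
    [TopologicalSpace (Tot V)] [MulAction G (Tot V)]
    (φ : ∀ x, E x →ₗ[𝕜] V x) : Prop :=
  (∀ (g : G) (e : Tot E),
    Tot.mk (g • e).proj (φ _ (g • e).snd) = g • Tot.mk e.proj (φ _ e.snd)) ∧
  IsEmbedding (fun e : Tot E => Tot.mk e.proj (φ _ e.snd))

end EqBundle

open EqBundle

-- The target can be a product bundle `X × W`, with `W` a finite-dimensional unitary representation
-- of `G`: it is the pullback of a local object with `K = G`. Over a trivializing set `U`, `E` is a
-- pullback of `G ×_K V`. Peter–Weyl theory on `L²(G)` places `V` inside the restriction to `K` of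
-- some such `W` (`exists_injective_intertwiner`), and `[g, v] ↦ g v` then exhibits `E` over `U` as
-- an equivariant retract of `U × W` (`IsTrivialOver.exists_isRetractOver`).
--
-- The finitely many inclusions are cut off by invariant bump functions and added up. The difficulty
-- sits at `F`: bump functions on the normal space `Fᶜ` need not extend continuously to `X`, and the
-- inclusions may blow up or degenerate on approaching `F`. Both problems disappear once each
-- inclusion distorts the norm of `E` by at most a constant factor. A bounded function times the
-- inclusion then tends to zero at `F`, because the norm is continuous and vanishes there.
-- Conversely, a small image forces a small norm, and smallness of the norm together with the base
-- point describes the neighbourhoods of a zero vector (`IsRetractOver.exists_isPartialInclusion`,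
-- `isEmbedding_of_isPartialInclusion`).
--
-- Bounded distortion comes from `exists_equivariant_normalization`. To a norm `N` on a
-- finite-dimensional Hilbert space attach the second moment `M` of the density proportional to `exp
-- (-N²)`. Then `w ↦ ‖M^(-1/2) w‖` is comparable to `N` with constants depending on the dimension
-- only, and `M` varies continuously with `N` and equivariantly under isometries. Since the action
-- on `E` need not be isometric, the norm of `E` is first replaced by its supremum over `G`.

universe v

namespace EqBundle

open MeasureTheory InnerProductSpace

/-! ### Peter–Weyl: finite-dimensional pieces of unitary representations -/

section PeterWeyl

variable {𝕜 G H : Type*} [RCLike 𝕜] [Group G] [TopologicalSpace G] [IsTopologicalGroup G]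
  [CompactSpace G] [NormedAddCommGroup H] [InnerProductSpace 𝕜 H] [CompleteSpace H]

/-- For a strongly continuous unitary representation of a compact group on a Hilbert space, every
nonzero vector has a nonzero component in some finite-dimensional invariant subspace. -/
theorem exists_finiteDimensional_invariant_submodule (τ : G →* (H ≃ₗᵢ[𝕜] H))
    (hτ : ∀ v, Continuous fun g => τ g v) (F : H) (hF : F ≠ 0) :
    ∃ W : Submodule 𝕜 H, FiniteDimensional 𝕜 W ∧ (∀ g, ∀ w ∈ W, τ g w ∈ W) ∧
      ∃ w ∈ W, inner 𝕜 w F ≠ 0 := by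
  borelize G
  let : NormedSpace ℝ H := NormedSpace.restrictScalars ℝ 𝕜 H
  let : NormedSpace ℝ (H →L[𝕜] H) := NormedSpace.restrictScalars ℝ 𝕜 (H →L[𝕜] H)
  have : IsScalarTower ℝ 𝕜 H := RestrictScalars.isScalarTower ℝ 𝕜 H
  have : IsScalarTower ℝ 𝕜 (H →L[𝕜] H) := RestrictScalars.isScalarTower ℝ 𝕜 (H →L[𝕜] H)
  let μ : Measure G := Measure.haarMeasure ⊤
  have : IsProbabilityMeasure μ := ⟨Measure.haarMeasure_self⟩
  have hint : ∀ {E : Type _} [NormedAddCommGroup E] {f : G → E}, Continuous f → Integrable f μ :=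
    fun hf => hf.integrable_of_hasCompactSupport (HasCompactSupport.of_compactSpace _)
  -- Averaging the rank-one operators of the orbit of `F` gives a compact, symmetric operator `S`
  -- commuting with `G` and with `⟨F, S F⟩ > 0`. Its eigenspaces for nonzero eigenvalues are
  -- finite-dimensional and invariant.
  let R : G → H →L[𝕜] H := fun g => rankOne 𝕜 (τ g F) (τ g F)
  have hRc : Continuous R :=
    (ContinuousLinearMap.smulRightL 𝕜 H H).continuous₂.comp
      (((innerSL 𝕜).continuous.comp (hτ F)).prodMk (hτ F))
  let S : H →L[𝕜] H := ∫ g, R g ∂μ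
  have hSapp : ∀ v, S v = ∫ g, inner 𝕜 (τ g F) v • τ g F ∂μ := fun v =>
    ((ContinuousLinearMap.apply 𝕜 H v).integral_comp_comm (hint hRc)).symm
  have hSc : IsCompactOperator S := by
    -- The compact operators form a closed convex set, which therefore contains averages of its
    -- elements.
    have hcl : IsClosed (compactOperator (RingHom.id 𝕜) H H : Set (H →L[𝕜] H)) :=
      isClosed_setOfPred_isCompactOperator
    have hconv : Convex ℝ (compactOperator (RingHom.id 𝕜) H H : Set (H →L[𝕜] H)) :=
      ((compactOperator (RingHom.id 𝕜) H H).restrictScalars ℝ).convex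
    refine hconv.integral_mem hcl (Filter.Eventually.of_forall fun g => ?_) (hint hRc)
    change IsCompactOperator (rankOne 𝕜 (τ g F) (τ g F))
    rw [rankOne_def']
    exact (isCompactOperator_of_locallyCompactSpace_rng
      (ContinuousLinearMap.toSpanSingleton 𝕜 (τ g F))).comp_clm _
  have hinn : ∀ v w, inner 𝕜 v (S w) = ∫ g, inner 𝕜 (τ g F) w * inner 𝕜 v (τ g F) ∂μ := by
    intro v w
    rw [hSapp, ← integral_inner]
    · simp [inner_smul_right]
    · apply hint
      exact ((hτ F).inner continuous_const).smul (hτ F)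
  have hSs : (S : H →ₗ[𝕜] H).IsSymmetric := by
    intro v w
    simp only [ContinuousLinearMap.coe_coe]
    rw [← inner_conj_symm, hinn, hinn, ← integral_conj]
    simp [mul_comm]
  have hSG : ∀ h v, τ h (S v) = S (τ h v) := by
    intro h v
    rw [hSapp, hSapp]
    have := ((τ h).toContinuousLinearEquiv : H →L[𝕜] H).integral_comp_comm
      (hint (((hτ F).inner (𝕜 := 𝕜) (continuous_const (y := v))).smul (hτ F)))
    rw [← integral_mul_left_eq_self (fun g => inner 𝕜 (τ g F) (τ h v) • τ g F) h]
    simpa using this.symm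
  have hSF : S F ≠ 0 := by
    intro h0
    have h1 := hinn F F
    rw [h0, inner_zero_right] at h1
    have h2 : ∀ g, inner 𝕜 (τ g F) F * inner 𝕜 F (τ g F) = ((‖inner 𝕜 F (τ g F)‖ ^ 2 : ℝ) : 𝕜) := by
      intro g
      rw [← inner_conj_symm (τ g F) F, RCLike.conj_mul]; simp
    simp only [h2] at h1
    rw [integral_ofReal, eq_comm, RCLike.ofReal_eq_zero] at h1
    have hc : Continuous fun g => ‖inner 𝕜 F (τ g F)‖ ^ 2 :=
      ((continuous_const.inner (hτ F)).norm).pow 2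
    refine absurd h1 (ne_of_gt ?_)
    refine hc.integral_pos_of_hasCompactSupport_nonneg_nonzero (HasCompactSupport.of_compactSpace _)
      (fun g => by positivity) (x := 1) ?_
    simpa using hF
  by_contra hcon
  push Not at hcon
  have hperp : ∀ c : 𝕜, c ≠ 0 → ∀ w ∈ Module.End.eigenspace (S : H →ₗ[𝕜] H) c,
      inner 𝕜 w F = 0 := by
    intro c hc
    refine hcon _ (ContinuousLinearMap.finite_dimensional_eigenspace hSc c hc) ?_
    intro g w hw
    rw [Module.End.mem_eigenspace_iff] at hw ⊢
    simp only [ContinuousLinearMap.coe_coe] at hw ⊢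
    rw [← hSG, hw, map_smul]
  -- If every such eigenspace were orthogonal to `F`, then `S F` would be orthogonal to all
  -- eigenspaces (the kernel included, by symmetry), hence zero by the spectral theorem.
  have hmem : S F ∈ (⨆ c, Module.End.eigenspace (S : H →ₗ[𝕜] H) c)ᗮ := by
    rw [← Submodule.iInf_orthogonal, Submodule.mem_iInf]
    intro c
    rw [Submodule.mem_orthogonal]
    intro w hw
    have h3 := hSs w F
    simp only [ContinuousLinearMap.coe_coe] at h3
    rw [← h3]
    have h4 : S w = c • w := Module.End.mem_eigenspace_iff.1 hw
    rw [h4, inner_smul_left]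
    rcases eq_or_ne c 0 with rfl | hc
    · simp
    · rw [hperp c hc w hw, mul_zero]
  rw [ContinuousLinearMap.orthogonalComplement_iSup_eigenspaces_eq_bot hSc hSs] at hmem
  exact hSF (by simpa using hmem)

end PeterWeyl

/-! ### Unitary representations and projection to finite-dimensional ones -/

section UnitaryEmbedding

variable {𝕜 G H : Type*} [RCLike 𝕜] [Group G] [NormedAddCommGroup H] [InnerProductSpace 𝕜 H]

/-- A unitary representation from a multiplicative family of norm-preserving linear maps. -/
def unitaryOfLinear (T : G → H →ₗ[𝕜] H) (h1 : ∀ v, T 1 v = v)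
    (hmul : ∀ g h v, T (g * h) v = T g (T h v)) (hn : ∀ g v, ‖T g v‖ = ‖v‖) :
    G →* (H ≃ₗᵢ[𝕜] H) :=
  MonoidHom.mk' (fun g =>
    { toLinearEquiv := LinearEquiv.ofLinearMap (T g) (T g⁻¹)
        (by ext v; simp [← hmul, h1]) (by ext v; simp [← hmul, h1])
      norm_map' := hn g })
    (by intro g h; ext v; exact hmul g h v)

/-- Strong continuity upgrades to joint continuity because the operators are isometries: an error in
the vector is not amplified. -/
theorem continuous_uncurry_unitary [TopologicalSpace G] (τ : G →* (H ≃ₗᵢ[𝕜] H))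
    (hτ : ∀ v, Continuous fun g => τ g v) : Continuous fun p : G × H => τ p.1 p.2 := by
  rw [continuous_iff_continuousAt]
  rintro ⟨g, v⟩
  rw [ContinuousAt, tendsto_iff_norm_sub_tendsto_zero]
  have h1 : Filter.Tendsto (fun p : G × H => ‖p.2 - v‖ + ‖τ p.1 v - τ g v‖) (𝓝 (g, v)) (𝓝 0) := by
    have : Continuous fun p : G × H => ‖p.2 - v‖ + ‖τ p.1 v - τ g v‖ :=
      (continuous_snd.sub continuous_const).norm.add
        ((((hτ v).comp continuous_fst).sub continuous_const).norm)
    simpa using this.tendsto (g, v)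
  refine squeeze_zero (fun _ => norm_nonneg _) (fun p => ?_) h1
  have h2 : ‖p.2 - v‖ = ‖τ p.1 p.2 - τ p.1 v‖ := by rw [← map_sub, LinearIsometryEquiv.norm_map]
  rw [h2]
  exact norm_sub_le_norm_sub_add_norm_sub _ _ _

variable [TopologicalSpace G] [IsTopologicalGroup G] [CompactSpace G] [CompleteSpace H]

/-- If a linear map `j` into a unitary representation of `G` intertwines some elements of `G` and
does not kill `v`, then so does one into a finite-dimensional unitary representation. -/
theorem exists_euclidean_intertwiner {A V : Type*} [AddCommGroup V] [Module 𝕜 V]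
    (τ : G →* (H ≃ₗᵢ[𝕜] H)) (hτ : ∀ v, Continuous fun g => τ g v) (c : A → G)
    (ρ : A → V → V) (j : V →ₗ[𝕜] H) (hj : ∀ a v, j (ρ a v) = τ (c a) (j v)) (v : V)
    (hv : j v ≠ 0) :
    ∃ (d : ℕ) (σ : G →* (EuclideanSpace 𝕜 (Fin d) ≃ₗᵢ[𝕜] EuclideanSpace 𝕜 (Fin d)))
      (ι : V →ₗ[𝕜] EuclideanSpace 𝕜 (Fin d)),
      (∀ w, Continuous fun g => σ g w) ∧ (∀ a v, ι (ρ a v) = σ (c a) (ι v)) ∧ ι v ≠ 0 := by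
  obtain ⟨W, hW, hinv, w₀, hw₀, hne⟩ := exists_finiteDimensional_invariant_submodule τ hτ (j v) hv
  let b := (stdOrthonormalBasis 𝕜 W).repr
  let r : G → W →ₗ[𝕜] W := fun g => (τ g).toLinearEquiv.toLinearMap.restrict (hinv g)
  have hr : ∀ g w, (r g w : H) = τ g w := fun g w => rfl
  let σ := unitaryOfLinear
    (fun g => b.toLinearEquiv.toLinearMap ∘ₗ r g ∘ₗ b.symm.toLinearEquiv.toLinearMap)
    (by
      intro v
      have : r 1 (b.symm v) = b.symm v := Subtype.ext (by simp [hr])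
      simp [this])
    (by
      intro g h v
      have : r (g * h) (b.symm v) = r g (r h (b.symm v)) := Subtype.ext (by simp [hr])
      simp [this])
    (by
      intro g v
      have : ‖r g (b.symm v)‖ = ‖b.symm v‖ := (τ g).norm_map (b.symm v : W)
      simp [this])
  have hσ : ∀ g w, σ g w = b (r g (b.symm w)) := fun g w => rfl
  -- The intertwiner is `j` followed by the orthogonal projection onto `W`. The projection is
  -- equivariant because `W` is invariant under inverses too, and `j v` survives since it is not
  -- orthogonal to `W`.
  refine ⟨_, σ, b.toLinearEquiv.toLinearMap ∘ₗ W.orthogonalProjectionOnto.toLinearMap ∘ₗ j,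
    fun w => ?_, fun a v => ?_, ?_⟩
  · simp only [hσ]
    refine b.continuous.comp (continuous_induced_rng.2 ?_)
    exact hτ (b.symm w : W)
  · simp only [LinearMap.comp_apply, hσ, hj]
    change b _ = b _
    congr 1
    apply Subtype.ext
    rw [hr]
    change W.starProjection _ = _
    apply Submodule.eq_starProjection_of_mem_of_inner_eq_zero
    · exact hinv _ _ (Subtype.mem _)
    · intro w hw
      change inner 𝕜 (τ (c a) (j v) - τ (c a) (((b.symm (b _)) : W) : H)) w = 0
      rw [b.symm_apply_apply, ← map_sub]
      have h1 : τ (c a) (τ (c a)⁻¹ w) = w := by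
        change (τ (c a) * τ (c a)⁻¹) w = w
        rw [← map_mul]; simp
      rw [← h1, LinearIsometryEquiv.inner_map_map]
      exact W.starProjection_inner_eq_zero _ _ (hinv _ _ hw)
  · intro h0
    have h1 : W.orthogonalProjectionOnto (j v) = 0 := by
      have : b (W.orthogonalProjectionOnto (j v)) = 0 := h0
      simpa using this
    apply hne
    have h2 := W.starProjection_inner_eq_zero (j v) w₀ hw₀
    have h3 : W.starProjection (j v) = 0 := by
      change ((W.orthogonalProjectionOnto (j v) : W) : H) = 0
      rw [h1]; rfl
    rw [h3, sub_zero] at h2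
    rw [← inner_conj_symm, h2, map_zero]

end UnitaryEmbedding

/-! ### The regular representation on `L²(G)` -/

section RegularRepresentation

variable (𝕜 : Type*) {G : Type*} [RCLike 𝕜] [Group G] [TopologicalSpace G] [IsTopologicalGroup G]
  [CompactSpace G] [MeasurableSpace G] [BorelSpace G]

/-- The left regular representation on `L²(G)`. -/
noncomputable def regularRep : G →* (Lp 𝕜 2 (Measure.haar : Measure G) ≃ₗᵢ[𝕜]
    Lp 𝕜 2 (Measure.haar : Measure G)) :=
  unitaryOfLinear (fun g =>
    { toFun := fun F => DomMulAct.mk g⁻¹ • F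
      map_add' := fun _ _ => smul_add _ _ _
      map_smul' := fun _ _ => smul_comm _ _ _ })
    (fun F => by simp)
    (fun g h F => by simp [mul_smul])
    (fun g F => DomMulAct.norm_smul_Lp _ _)

theorem regularRep_apply (g : G) (F : Lp 𝕜 2 (Measure.haar : Measure G)) :
    regularRep 𝕜 g F = DomMulAct.mk g⁻¹ • F := rfl

theorem continuous_regularRep (F : Lp 𝕜 2 (Measure.haar : Measure G)) :
    Continuous fun g => regularRep 𝕜 g F := by
  simp only [regularRep_apply]
  have : Fact ((2 : ENNReal) ≠ ⊤) := ⟨by simp⟩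
  exact (DomMulAct.continuous_mk.comp continuous_inv).smul continuous_const

end RegularRepresentation

/-! ### Detecting a vector of a `K`-representation by a `G`-representation -/

section Frobenius

variable {𝕜 G : Type*} [RCLike 𝕜] [Group G] [TopologicalSpace G] [IsTopologicalGroup G]
  [T2Space G] [CompactSpace G]

/-- For a functional `ξ` on `V` and `u ∈ L²(G)`, the average over `k ∈ K` of `ξ (k⁻¹ w) • k u` is a
`K`-equivariant function of `w`, by invariance of Haar measure. With `u` the indicator of a small
neighbourhood of `1`, its pairing with `u` only sees `k` near `1`, where `ξ (k⁻¹ v)` has positive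
real part; hence `v` is not killed. -/
theorem exists_intertwiner_ne_zero (K : Subgroup G) (hK : IsClosed (K : Set G)) {n : ℕ}
    (ρ : Representation 𝕜 K (Fin n → 𝕜))
    (hρ : Continuous fun p : K × (Fin n → 𝕜) => ρ p.1 p.2) (v : Fin n → 𝕜) (hv : v ≠ 0) :
    ∃ (d : ℕ) (σ : G →* (EuclideanSpace 𝕜 (Fin d) ≃ₗᵢ[𝕜] EuclideanSpace 𝕜 (Fin d)))
      (ι : (Fin n → 𝕜) →ₗ[𝕜] EuclideanSpace 𝕜 (Fin d)),
      (∀ w, Continuous fun g => σ g w) ∧ (∀ (k : K) v, ι (ρ k v) = σ k (ι v)) ∧ ι v ≠ 0 := by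
  borelize G
  have : CompactSpace K := isCompact_iff_compactSpace.1 hK.isCompact
  let τ := regularRep 𝕜 (G := G)
  have hτ := continuous_regularRep 𝕜 (G := G)
  obtain ⟨i, hi⟩ := Function.ne_iff.1 hv
  -- Normalized so that `ξ v = |v i|² > 0`.
  let ξ : (Fin n → 𝕜) →ₗ[𝕜] 𝕜 := star (v i) • LinearMap.proj i
  have hξ : ∀ w, ξ w = star (v i) * w i := fun w => rfl
  have hξc : Continuous ξ := by
    change Continuous fun w : Fin n → 𝕜 => star (v i) * w i
    exact continuous_const.mul (continuous_apply i)
  have hξK : ∀ w, Continuous fun k : K => ξ (ρ k⁻¹ w) := fun w =>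
    hξc.comp (hρ.comp (continuous_inv.prodMk continuous_const))
  have hξv : 0 < RCLike.re (ξ v) := by
    have h : ξ v = ((‖v i‖ ^ 2 : ℝ) : 𝕜) := by
      rw [hξ, RCLike.star_def, RCLike.conj_mul]; simp
    rw [h, RCLike.ofReal_re]
    have : 0 < ‖v i‖ := norm_pos_iff.2 hi
    positivity
  -- If `O` meets `k O` then `k ∈ O O⁻¹`, so it suffices to take `O O⁻¹` inside a neighbourhood of
  -- `1` on which the real part is positive.
  obtain ⟨O, hO, hO1, hON⟩ : ∃ O : Set G, IsOpen O ∧ 1 ∈ O ∧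
      ∀ k : K, (∃ g ∈ O, (k : G)⁻¹ * g ∈ O) → 0 < RCLike.re (ξ (ρ k⁻¹ v)) := by
    have h1 : {k : K | 0 < RCLike.re (ξ (ρ k⁻¹ v))} ∈ 𝓝 (1 : K) := by
      refine (isOpen_lt continuous_const (RCLike.continuous_re.comp (hξK v))).mem_nhds ?_
      simpa using hξv
    rw [nhds_induced, Filter.mem_comap] at h1
    obtain ⟨N, hN, hNK⟩ := h1
    obtain ⟨V, hV, hVN⟩ := exists_nhds_split_inv hN
    refine ⟨interior V, isOpen_interior, mem_interior_iff_mem_nhds.2 hV, ?_⟩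
    rintro k ⟨g, hg, hkg⟩
    have h2 := hVN g (interior_subset hg) _ (interior_subset hkg)
    apply hNK
    simpa [div_eq_mul_inv] using h2
  let μ : Measure G := Measure.haar
  let u : Lp 𝕜 2 μ := indicatorConstLp 2 hO.measurableSet (measure_ne_top μ O) 1
  let m : K → ℝ := fun k => μ.real (O ∩ ((k : G)⁻¹ • ·) ⁻¹' O)
  have hm : ∀ k : K, inner 𝕜 u (τ k u) = (m k : 𝕜) := by
    intro k
    change inner 𝕜 u (DomMulAct.mk (k : G)⁻¹ • u) = _
    rw [DomMulAct.mk_smul_indicatorConstLp, L2.inner_indicatorConstLp_indicatorConstLp]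
    simp [m, Algebra.smul_def]
  have hmre : ∀ k, m k = RCLike.re (inner 𝕜 u (τ k u)) := fun k => by
    rw [hm, RCLike.ofReal_re]
  have hmc : Continuous m := by
    rw [funext hmre]
    exact RCLike.continuous_re.comp (continuous_const.inner ((hτ u).comp continuous_subtype_val))
  let ν : Measure K := Measure.haar
  have hfc : ∀ w, Continuous fun k : K => ξ (ρ k⁻¹ w) • τ k u := fun w =>
    (hξK w).smul ((hτ u).comp continuous_subtype_val)
  have hfi : ∀ w, Integrable (fun k : K => ξ (ρ k⁻¹ w) • τ k u) ν := fun w =>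
    (hfc w).integrable_of_hasCompactSupport (HasCompactSupport.of_compactSpace _)
  let j : (Fin n → 𝕜) →ₗ[𝕜] Lp 𝕜 2 μ :=
    { toFun := fun w => ∫ k : K, ξ (ρ k⁻¹ w) • τ k u ∂ν
      map_add' := fun w w' => by
        rw [← integral_add (hfi w) (hfi w')]
        simp [add_smul]
      map_smul' := fun c w => by
        rw [RingHom.id_apply, ← integral_smul]
        simp [mul_smul] }
  have hj : ∀ w, j w = ∫ k : K, ξ (ρ k⁻¹ w) • τ k u ∂ν := fun w => rfl
  refine exists_euclidean_intertwiner τ hτ (fun k : K => (k : G)) (fun k => ρ k) j ?_ v ?_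
  · intro a w
    have h1 := ((τ a).toContinuousLinearEquiv : Lp 𝕜 2 μ →L[𝕜] Lp 𝕜 2 μ).integral_comp_comm (hfi w)
    rw [hj, hj, ← integral_mul_left_eq_self _ a]
    refine Eq.trans ?_ h1
    congr 1
    ext1 k
    have h2 : ρ (a * k)⁻¹ (ρ a w) = ρ k⁻¹ w := by
      rw [← Module.End.mul_apply, ← map_mul]; simp
    rw [h2]
    simp
  · intro h0
    have h1 : inner 𝕜 u (j v) = ∫ k : K, ξ (ρ k⁻¹ v) * (m k : 𝕜) ∂ν := by
      rw [hj, ← integral_inner (hfi v)]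
      simp only [inner_smul_right, hm]
    have hc : Continuous fun k : K => RCLike.re (ξ (ρ k⁻¹ v)) * m k :=
      (RCLike.continuous_re.comp (hξK v)).mul hmc
    have h2 : RCLike.re (inner 𝕜 u (j v)) = ∫ k : K, RCLike.re (ξ (ρ k⁻¹ v)) * m k ∂ν := by
      rw [h1, ← integral_re]
      · simp
      · exact ((hξK v).mul (RCLike.continuous_ofReal.comp hmc)).integrable_of_hasCompactSupport
          (HasCompactSupport.of_compactSpace _)
    have h3 : 0 < ∫ k : K, RCLike.re (ξ (ρ k⁻¹ v)) * m k ∂ν := by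
      refine hc.integral_pos_of_hasCompactSupport_nonneg_nonzero
        (HasCompactSupport.of_compactSpace _) (fun k => ?_) (x := 1) ?_
      · rcases Set.eq_empty_or_nonempty (O ∩ ((k : G)⁻¹ • ·) ⁻¹' O) with he | ⟨g, hg⟩
        · have h5 : m k = 0 := by simp only [m, he, measureReal_empty]
          simp [h5]
        · exact mul_nonneg (hON k ⟨g, hg.1, hg.2⟩).le measureReal_nonneg
      · have h4 : 0 < m 1 := by
          have : μ O ≠ 0 := (hO.measure_pos μ ⟨1, hO1⟩).ne'
          simp only [m, OneMemClass.coe_one, inv_one, one_smul, Set.preimage_id', Set.inter_self]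
          exact ENNReal.toReal_pos this (measure_ne_top μ O)
        simpa using ⟨hξv.ne', h4.ne'⟩
    rw [h0, inner_zero_right] at h2
    simp at h2
    exact h3.ne h2

end Frobenius

/-! ### Direct sums of unitary representations -/

section DirectSum

variable {𝕜 G I : Type*} [RCLike 𝕜] [Group G] [Fintype I] {W : I → Type*}
  [∀ i, NormedAddCommGroup (W i)] [∀ i, InnerProductSpace 𝕜 (W i)]

/-- The orthogonal direct sum of unitary representations. -/
noncomputable def piRep (σ : ∀ i, G →* (W i ≃ₗᵢ[𝕜] W i)) : G →* (PiLp 2 W ≃ₗᵢ[𝕜] PiLp 2 W) :=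
  MonoidHom.mk' (fun g => LinearIsometryEquiv.piLpCongrRight 2 fun i => σ i g) (by
    intro g h
    ext w i
    simp)

theorem continuous_piRep [TopologicalSpace G] (σ : ∀ i, G →* (W i ≃ₗᵢ[𝕜] W i))
    (hσ : ∀ i w, Continuous fun g => σ i g w) (w : PiLp 2 W) :
    Continuous fun g => piRep σ g w :=
  (PiLp.continuous_toLp 2 W).comp (continuous_pi fun i => hσ i (w i))

end DirectSum

/-! ### Embedding a `K`-representation into a `G`-representation -/

section Frobenius

variable {𝕜 : Type w} {G : Type*} [RCLike 𝕜] [Group G] [TopologicalSpace G]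
  [IsTopologicalGroup G] [T2Space G] [CompactSpace G]

/-- Every finite-dimensional representation of a closed subgroup of a compact group embeds into the
restriction of a finite-dimensional unitary representation of the group. -/
theorem exists_injective_intertwiner (K : Subgroup G) (hK : IsClosed (K : Set G)) {n : ℕ}
    (ρ : Representation 𝕜 K (Fin n → 𝕜))
    (hρ : Continuous fun p : K × (Fin n → 𝕜) => ρ p.1 p.2) :
    ∃ (W : Type w) (_ : NormedAddCommGroup W) (_ : InnerProductSpace 𝕜 W)
      (_ : FiniteDimensional 𝕜 W) (σ : G →* (W ≃ₗᵢ[𝕜] W)) (ι : (Fin n → 𝕜) →ₗ[𝕜] W),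
      (∀ w, Continuous fun g => σ g w) ∧ (∀ (k : K) v, ι (ρ k v) = σ k (ι v)) ∧
        Function.Injective ι := by
  classical
  choose d σ ι hσ hι hne using exists_intertwiner_ne_zero K hK ρ hρ
  let A := {v : Fin n → 𝕜 // v ≠ 0}
  let κ : A → Submodule 𝕜 (Fin n → 𝕜) := fun a => LinearMap.ker (ι a.1 a.2)
  -- A minimal finite intersection of kernels is zero: a nonzero `v` in it could be removed by
  -- adding the intertwiner chosen for `v`. So finitely many intertwiners already separate points.
  obtain ⟨_, ⟨s, rfl⟩, hs⟩ := IsArtinian.set_has_minimal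
    (Set.range fun s : Finset A => s.inf κ) ⟨_, ⟨∅, rfl⟩⟩
  refine ⟨PiLp 2 fun a : s => EuclideanSpace 𝕜 (Fin (d a.1.1 a.1.2)), inferInstance,
    inferInstance, inferInstance, piRep fun a : s => σ a.1.1 a.1.2,
    (WithLp.linearEquiv 2 𝕜 _).symm.toLinearMap ∘ₗ LinearMap.pi fun a : s => ι a.1.1 a.1.2,
    continuous_piRep _ fun a => hσ a.1.1 a.1.2, ?_, ?_⟩
  · intro k v
    ext1 a
    exact hι _ _ k v
  · rw [← LinearMap.ker_eq_bot, LinearMap.ker_eq_bot']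
    intro v hv
    by_contra hv0
    have h1 : v ∈ s.inf κ := by
      rw [Submodule.mem_finsetInf]
      intro a ha
      exact congrArg (fun x => x ⟨a, ha⟩) hv
    refine hs _ ⟨insert ⟨v, hv0⟩ s, rfl⟩ (lt_of_le_of_ne ?_ fun he => ?_)
    · exact Finset.inf_mono (Finset.subset_insert _ _)
    · simp only at he
      rw [← he, Finset.inf_insert] at h1
      exact hne v hv0 h1.1

end Frobenius

/-! ### Trivial pieces of `E` as equivariant retracts of `U × W` -/

section LocalModel

variable {𝕜 : Type w} {G : Type*} [RCLike 𝕜] [Group G]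

/-- The orthogonal projection onto an invariant subspace is equivariant. -/
theorem starProjection_apply_of_invariant {H : Type*} [NormedAddCommGroup H]
    [InnerProductSpace 𝕜 H] (W : Submodule 𝕜 H) [W.HasOrthogonalProjection] (T : H ≃ₗᵢ[𝕜] H)
    (hT : ∀ w ∈ W, T w ∈ W) (hT' : ∀ w ∈ W, T.symm w ∈ W) (x : H) :
    W.starProjection (T x) = T (W.starProjection x) := by
  apply Submodule.eq_starProjection_of_mem_of_inner_eq_zero
  · exact hT _ (Subtype.mem _)
  · intro w hw
    rw [← map_sub, ← T.apply_symm_apply w, LinearIsometryEquiv.inner_map_map]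
    exact W.starProjection_inner_eq_zero _ _ (hT' _ hw)

/-- The range of `ι` is `K`-invariant and `σ` is unitary, so the orthogonal projection onto it
commutes with `K`; compose with the inverse of `ι`. -/
theorem exists_equivariant_retraction {K : Subgroup G} {n : ℕ}
    {ρ : Representation 𝕜 K (Fin n → 𝕜)} {W : Type*} [NormedAddCommGroup W]
    [InnerProductSpace 𝕜 W] [FiniteDimensional 𝕜 W] (σ : G →* (W ≃ₗᵢ[𝕜] W))
    (ι : (Fin n → 𝕜) →ₗ[𝕜] W) (hι : ∀ (k : K) v, ι (ρ k v) = σ k (ι v))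
    (hinj : Function.Injective ι) :
    ∃ p : W →ₗ[𝕜] (Fin n → 𝕜), (∀ v, p (ι v) = v) ∧ ∀ (k : K) w, p (σ k w) = ρ k (p w) := by
  let R := LinearMap.range ι
  let e := LinearEquiv.ofInjective ι hinj
  have he : ∀ y : R, ι (e.symm y) = y := fun y => by
    conv_rhs => rw [← e.apply_symm_apply y]
    rfl
  let p : W →ₗ[𝕜] (Fin n → 𝕜) := e.symm.toLinearMap ∘ₗ R.orthogonalProjectionOnto.toLinearMap
  have hp : ∀ w, ι (p w) = R.starProjection w := fun w => he _
  have hmem : ∀ (k : K), ∀ y ∈ R, σ k y ∈ R := by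
    rintro k _ ⟨v, rfl⟩
    exact ⟨ρ k v, hι k v⟩
  refine ⟨p, fun v => hinj ?_, fun k w => hinj ?_⟩
  · rw [hp]
    exact Submodule.starProjection_eq_self_iff.2 ⟨v, rfl⟩
  · rw [hp, hι, hp]
    refine starProjection_apply_of_invariant R (σ k) (hmem k) (fun y hy => ?_) w
    have h1 := hmem k⁻¹ y hy
    rwa [Subgroup.coe_inv, map_inv] at h1

namespace LocalObject

variable {K : Subgroup G} {n : ℕ} {ρ : Representation 𝕜 K (Fin n → 𝕜)}

/-- The projection `G ×_K V → G ⧸ K`. -/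
def proj (z : LocalObject K ρ) : G ⧸ K :=
  Quotient.lift (fun q : G × (Fin n → 𝕜) => (q.1 : G ⧸ K)) (by
    rintro ⟨g, v⟩ ⟨g', v'⟩ ⟨k, h1, -⟩
    simp only at h1
    simp [h1]) z

theorem smul_mk (h g : G) (v : Fin n → 𝕜) : h • mk ρ g v = mk ρ (h * g) v := rfl

theorem proj_smul (h : G) (z : LocalObject K ρ) : (h • z).proj = h • z.proj := by
  induction z using Quotient.inductionOn with
  | h q => rfl

theorem mk_mul (g : G) (k : K) (v : Fin n → 𝕜) : mk ρ (g * k) v = mk ρ g (ρ k v) :=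
  (Quotient.sound (s := balanced K ρ) ⟨k, rfl, rfl⟩ :
    Quotient.mk (balanced K ρ) (g, ρ k v) = Quotient.mk (balanced K ρ) (g * k, v)).symm

theorem continuous_mk [TopologicalSpace G] :
    Continuous fun q : G × (Fin n → 𝕜) => mk ρ q.1 q.2 :=
  continuous_quotient_mk'

variable {W : Type*} [NormedAddCommGroup W] [InnerProductSpace 𝕜 W] (σ : G →* (W ≃ₗᵢ[𝕜] W))

/-- The map `[g, v] ↦ g (ι v)`. -/
def toRep (ι : (Fin n → 𝕜) →ₗ[𝕜] W) (hι : ∀ (k : K) v, ι (ρ k v) = σ k (ι v))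
    (z : LocalObject K ρ) : W :=
  Quotient.lift (fun q : G × (Fin n → 𝕜) => σ q.1 (ι q.2)) (by
    rintro ⟨g, v⟩ ⟨g', v'⟩ ⟨k, h1, h2⟩
    simp only at h1 h2
    simp [h1, h2, hι]) z

section toRep

variable (ι : (Fin n → 𝕜) →ₗ[𝕜] W) (hι : ∀ (k : K) v, ι (ρ k v) = σ k (ι v))

theorem toRep_smul (g : G) (z : LocalObject K ρ) :
    (g • z).toRep σ ι hι = σ g (z.toRep σ ι hι) := by
  induction z using Quotient.inductionOn with
  | h q =>
    change σ (g * q.1) (ι q.2) = σ g (σ q.1 (ι q.2))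
    simp

theorem continuous_toRep [TopologicalSpace G] (hσ : ∀ w, Continuous fun g => σ g w) :
    Continuous (toRep σ ι hι) :=
  Continuous.quotient_lift ((continuous_uncurry_unitary σ hσ).comp
    (continuous_fst.prodMk (ι.continuous_of_finiteDimensional.comp continuous_snd))) _

end toRep

/-- The map `(g K, w) ↦ [g, p (g⁻¹ w)]`. -/
def ofRep (p : W →ₗ[𝕜] (Fin n → 𝕜)) (hp : ∀ (k : K) w, p (σ k w) = ρ k (p w))
    (q : (G ⧸ K) × W) : LocalObject K ρ :=
  Quotient.liftOn' q.1 (fun g => mk ρ g (p (σ g⁻¹ q.2))) (by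
    intro g h hgh
    obtain ⟨k, rfl⟩ : ∃ k : K, h = g * k := ⟨⟨_, QuotientGroup.leftRel_apply.1 hgh⟩, by simp⟩
    rw [mk_mul, ← hp]
    simp)

section ofRep

variable (p : W →ₗ[𝕜] (Fin n → 𝕜)) (hp : ∀ (k : K) w, p (σ k w) = ρ k (p w))

theorem ofRep_mk (g : G) (w : W) : ofRep σ p hp ((g : G ⧸ K), w) = mk ρ g (p (σ g⁻¹ w)) := rfl

theorem smul_ofRep (h : G) (q : (G ⧸ K) × W) :
    h • ofRep σ p hp q = ofRep σ p hp (h • q.1, σ h q.2) := by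
  obtain ⟨q, w⟩ := q
  induction q using QuotientGroup.induction_on with
  | H g =>
    change _ = ofRep σ p hp (((h * g : G) : G ⧸ K), σ h w)
    rw [ofRep_mk, ofRep_mk, smul_mk]
    simp

theorem continuous_ofRep [FiniteDimensional 𝕜 W] [TopologicalSpace G] [IsTopologicalGroup G]
    (hσ : ∀ w, Continuous fun g => σ g w) : Continuous (ofRep σ p hp) := by
  -- A product of quotient maps need not be one; openness of `G → G ⧸ K` rescues this case.
  have h1 : IsOpenQuotientMap (Prod.map (QuotientGroup.mk : G → G ⧸ K) (id : W → W)) :=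
    QuotientGroup.isOpenQuotientMap_mk.prodMap .id
  rw [h1.isQuotientMap.continuous_iff]
  exact continuous_mk.comp (continuous_fst.prodMk (p.continuous_of_finiteDimensional.comp
    ((continuous_uncurry_unitary σ hσ).comp (continuous_fst.inv.prodMk continuous_snd))))

end ofRep

end LocalObject

variable [TopologicalSpace G] {X : Type*} [TopologicalSpace X] [MulAction G X]
  {E : X → Type*} [∀ x, AddCommGroup (E x)]
  [∀ x, Module 𝕜 (E x)] [TopologicalSpace (Tot E)] [MulAction G (Tot E)]

theorem IsLinearBundle.proj_smul (hE : IsLinearBundle 𝕜 G E) (g : G) (e : Tot E) :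
    (g • e).proj = g • e.proj := by
  obtain ⟨L, hL⟩ := hE.act_linear g e.proj
  exact congrArg TotalSpace.proj (hL e.snd)

/-- `a` and `b` exhibit `E` over `U` as an equivariant retract of `U × W`. -/
structure IsRetractOver (U : Set X) {W : Type*} [NormedAddCommGroup W] [InnerProductSpace 𝕜 W]
    (σ : G →* (W ≃ₗᵢ[𝕜] W)) (a : ∀ x, E x →ₗ[𝕜] W) (b : ∀ x, W →ₗ[𝕜] E x) : Prop where
  isOpen : IsOpen U
  invariant : Invariant G U
  continuous_rep : ∀ w, Continuous fun g => σ g w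
  left_inv : ∀ x ∈ U, ∀ v, b x (a x v) = v
  continuousOn_incl : ContinuousOn (fun e : Tot E => a e.proj e.snd) {e | e.proj ∈ U}
  continuousOn_retr : ContinuousOn (fun p : X × W => Tot.mk p.1 (b p.1 p.2)) (U ×ˢ Set.univ)
  incl_smul : ∀ (g : G) (e : Tot E), e.proj ∈ U → a _ (g • e).snd = σ g (a _ e.snd)
  retr_smul : ∀ (g : G), ∀ x ∈ U, ∀ w,
    Tot.mk (g • x) (b (g • x) (σ g w)) = g • Tot.mk x (b x w)

variable [IsTopologicalGroup G] [T2Space G] [CompactSpace G]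

/-- The inclusion is `Φ` followed by `[g, v] ↦ g (ι v)`; the retraction sends `(x, w)` to the point
over `x` whose `Φ`-image is `[g, p (g⁻¹ w)]`, where `f x = g K`. In the fibre formulas the
representatives `γ x` are chosen without continuity; continuity and equivariance are instead read
off through `Φ`, which sees only the class. -/
theorem IsTrivialOver.exists_isRetractOver (hE : IsLinearBundle 𝕜 G E) {U : Set X}
    (hU : IsTrivialOver 𝕜 G E U) :
    ∃ (W : Type w) (_ : NormedAddCommGroup W) (_ : InnerProductSpace 𝕜 W)
      (_ : FiniteDimensional 𝕜 W) (σ : G →* (W ≃ₗᵢ[𝕜] W)) (a : ∀ x, E x →ₗ[𝕜] W)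
      (b : ∀ x, W →ₗ[𝕜] E x), IsRetractOver U σ a b := by
  classical
  obtain ⟨hUo, hUi, K, n, ρ, f, Φ, hK, hρ, hf, hΦ, hΦG, hemb⟩ := hU
  obtain ⟨W, _, _, _, σ, ι, hσ, hι, hinj⟩ := exists_injective_intertwiner K hK ρ hρ
  obtain ⟨p, hpι, hp⟩ := exists_equivariant_retraction σ ι hι hinj
  choose! γ hγ using hΦ
  choose L hL using hγ
  let a : ∀ x, E x →ₗ[𝕜] W := fun x =>
    if hx : x ∈ U then (σ (γ x)).toLinearEquiv.toLinearMap ∘ₗ ι ∘ₗ (L x hx).toLinearMap else 0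
  let b : ∀ x, W →ₗ[𝕜] E x := fun x =>
    if hx : x ∈ U then
      (L x hx).symm.toLinearMap ∘ₗ p ∘ₗ (σ (γ x)⁻¹).toLinearEquiv.toLinearMap else 0
  have ha : ∀ x (hx : x ∈ U) v, a x v = σ (γ x) (ι (L x hx v)) := fun x hx v => by
    simp [a, hx]
  have hb : ∀ x (hx : x ∈ U) w, b x w = (L x hx).symm (p (σ (γ x)⁻¹ w)) := fun x hx v => by
    simp only [b, hx, dif_pos]; rfl
  have haΦ : ∀ e : Tot E, e.proj ∈ U → a e.proj e.snd = (Φ e).toRep σ ι hι := fun e he => by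
    have h1 := (hL _ he).2 e.snd
    rw [ha _ he]
    exact (congrArg (LocalObject.toRep σ ι hι) h1).symm
  have hbΦ : ∀ x ∈ U, ∀ w, Φ (Tot.mk x (b x w)) = LocalObject.ofRep σ p hp (f x, w) := by
    intro x hx w
    rw [(hL x hx).2, (hL x hx).1, hb x hx, LinearEquiv.apply_symm_apply]
    rfl
  have hfΦ : ∀ e : Tot E, e.proj ∈ U → (Φ e).proj = f e.proj := fun e he => by
    have h1 := (hL _ he).2 e.snd
    rw [(hL _ he).1]
    exact congrArg LocalObject.proj h1
  have hfG : ∀ g : G, ∀ x ∈ U, f (g • x) = g • f x := by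
    intro g x hx
    -- Equivariance of `f` follows from that of `Φ`, evaluated on the zero section.
    have h1 := hΦG g (Tot.mk x 0) hx
    have h2 : (g • Tot.mk x (0 : E x)).proj = g • x := hE.proj_smul g _
    rw [← h2, ← hfΦ _ (by rw [h2]; exact hUi g x hx), h1, LocalObject.proj_smul, hfΦ _ hx]
  refine ⟨W, _, _, ‹_›, σ, a, b, hUo, hUi, hσ, fun x hx v => ?_, ?_, ?_, fun g e he => ?_,
    fun g x hx w => ?_⟩
  · rw [ha x hx, hb x hx, LinearEquiv.symm_apply_eq]
    simp [hpι]
  · rw [continuousOn_iff_continuous_domRestrict]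
    refine ((LocalObject.continuous_toRep σ ι hι hσ).comp hemb.continuous.snd).congr fun e => ?_
    exact (haΦ e.1 e.2).symm
  · rw [continuousOn_iff_continuous_domRestrict]
    let s : (U ×ˢ (Set.univ : Set W) : Set (X × W)) → {e : Tot E // e.proj ∈ U} :=
      fun q => ⟨Tot.mk q.1.1 (b q.1.1 q.1.2), q.2.1⟩
    have hs : Continuous s := by
      rw [hemb.continuous_iff]
      have h1 : Continuous fun q : (U ×ˢ (Set.univ : Set W) : Set (X × W)) => q.1.1 :=
        continuous_fst.comp continuous_subtype_val
      have h2 : Continuous fun q : (U ×ˢ (Set.univ : Set W) : Set (X × W)) => f q.1.1 :=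
        hf.comp_continuous h1 fun q => q.2.1
      refine (h1.prodMk ((LocalObject.continuous_ofRep σ p hp hσ).comp
        (h2.prodMk (continuous_snd.comp continuous_subtype_val)))).congr fun q => ?_
      exact Prod.ext rfl (hbΦ _ q.2.1 _).symm
    exact continuous_subtype_val.comp hs
  · have h1 : (g • e).proj ∈ U := by rw [hE.proj_smul]; exact hUi g _ he
    rw [haΦ _ h1, hΦG g e he, LocalObject.toRep_smul, haΦ _ he]
  · have h1 : (g • Tot.mk x (b x w)).proj = g • x := hE.proj_smul g _
    have h2 : g • x ∈ U := hUi g x hx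
    have h3 := @hemb.injective ⟨Tot.mk (g • x) (b (g • x) (σ g w)), h2⟩
      ⟨g • Tot.mk x (b x w), by rw [h1]; exact h2⟩ (by
        refine Prod.ext h1.symm ?_
        change Φ _ = Φ _
        rw [hbΦ _ h2, hΦG _ _ hx, hbΦ _ hx, LocalObject.smul_ofRep, hfG g x hx])
    exact congrArg Subtype.val h3

end LocalModel

/-! ### Positive square roots: uniqueness and continuity -/

section OperatorSqrt

variable {𝕜 W : Type*} [RCLike 𝕜] [NormedAddCommGroup W] [InnerProductSpace 𝕜 W]
  [FiniteDimensional 𝕜 W]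

theorem exists_isPositive_mul_self {T : W →L[𝕜] W} (hT : T.IsPositive) :
    ∃ S : W →L[𝕜] W, S.IsPositive ∧ S * S = T := by
  have hsym : (T : W →ₗ[𝕜] W).IsSymmetric := hT.isSymmetric
  let b := hsym.eigenvectorBasis rfl
  let c := hsym.eigenvalues rfl
  have hTb : ∀ i, T (b i) = (c i : 𝕜) • b i := fun i => hsym.apply_eigenvectorBasis rfl i
  have hc : ∀ i, 0 ≤ c i := by
    intro i
    have h1 := hT.re_inner_nonneg_right (b i)
    rw [hTb, inner_smul_right, inner_self_eq_norm_sq_to_K, b.norm_eq_one] at h1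
    simpa using h1
  let S : W →L[𝕜] W := ∑ i, ((√(c i) : ℝ) : 𝕜) • rankOne 𝕜 (b i) (b i)
  have hSb : ∀ i, S (b i) = ((√(c i) : ℝ) : 𝕜) • b i := by
    intro i
    simp only [S, sum_apply, smul_apply, rankOne_apply,
      b.inner_eq_ite, ite_smul, one_smul, zero_smul, smul_ite, smul_zero]
    simp
  refine ⟨S, ?_, ?_⟩
  · refine ContinuousLinearMap.isPositive_sum _ fun i _ => ?_
    exact (InnerProductSpace.isPositive_rankOne_self (b i)).smul_of_nonneg
      (RCLike.ofReal_nonneg.2 (Real.sqrt_nonneg _))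
  · apply ContinuousLinearMap.coe_injective
    refine b.toBasis.ext fun i => ?_
    simp only [OrthonormalBasis.coe_toBasis, ContinuousLinearMap.coe_coe,
      mul_apply_eq_comp, hSb, map_smul, hTb, smul_smul]
    rw [← RCLike.ofReal_mul, Real.mul_self_sqrt (hc i)]

/-- Let `x` be a unit eigenvector of `S - S'` with eigenvalue `c`, and put `p = ⟨x, S x⟩ ≥ 0`, `q =
⟨x, S' x⟩ ≥ 0`. Then `c = p - q`, while `⟨x, (S² - S'²) x⟩` has real part `c (p + q)`. Hence `c² ≤
|c| (p + q) ≤ ‖S² - S'²‖`. This yields both uniqueness and continuity of square roots. -/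
theorem norm_sub_le_sqrt_of_isPositive {S S' : W →L[𝕜] W} (hS : S.IsPositive)
    (hS' : S'.IsPositive) : ‖S - S'‖ ≤ √‖S * S - S' * S'‖ := by
  set D := S - S' with hD
  have hsym : (D : W →ₗ[𝕜] W).IsSymmetric := by
    have := hS.isSymmetric.sub hS'.isSymmetric
    simpa [hD] using this
  let b := hsym.eigenvectorBasis rfl
  let c := hsym.eigenvalues rfl
  have hDb : ∀ i, D (b i) = (c i : 𝕜) • b i := fun i => hsym.apply_eigenvectorBasis rfl i
  set ε := ‖S * S - S' * S'‖
  have hc : ∀ i, c i ^ 2 ≤ ε := by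
    intro i
    have h1 : inner 𝕜 (b i) ((S * S - S' * S') (b i)) =
        (c i : 𝕜) * (inner 𝕜 (b i) (S (b i)) + inner 𝕜 (b i) (S' (b i))) := by
      have h2 : (S * S - S' * S') (b i) = S (D (b i)) + D (S' (b i)) := by
        simp [hD]
      have h3 : inner 𝕜 (b i) (D (S' (b i))) = inner 𝕜 (D (b i)) (S' (b i)) :=
        (hsym (b i) (S' (b i))).symm
      rw [h2, inner_add_right, h3, hDb, map_smul, inner_smul_right, inner_smul_left]
      simp [mul_add]
    have h4 : c i = RCLike.re (inner 𝕜 (b i) (S (b i))) - RCLike.re (inner 𝕜 (b i) (S' (b i))) := by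
      have h5 : inner 𝕜 (b i) (D (b i)) = (c i : 𝕜) := by
        rw [hDb, inner_smul_right, inner_self_eq_norm_sq_to_K, b.norm_eq_one]
        simp
      rw [← map_sub, ← inner_sub_right]
      have h6 : S (b i) - S' (b i) = D (b i) := by simp [hD]
      rw [h6, h5, RCLike.ofReal_re]
    have p1 := hS.re_inner_nonneg_right (b i)
    have p2 := hS'.re_inner_nonneg_right (b i)
    have h7 : ‖inner 𝕜 (b i) ((S * S - S' * S') (b i))‖ ≤ ε := by
      refine (norm_inner_le_norm _ _).trans ?_
      have := (S * S - S' * S').le_opNorm (b i)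
      rw [b.norm_eq_one] at this ⊢
      simpa using this
    have h8 := (RCLike.abs_re_le_norm _).trans h7
    rw [h1, RCLike.re_ofReal_mul, map_add] at h8
    rw [abs_le] at h8
    generalize RCLike.re (inner 𝕜 (b i) (S (b i))) = p at *
    generalize RCLike.re (inner 𝕜 (b i) (S' (b i))) = q at *
    rw [h4] at h8 ⊢
    rcases le_total p q with hpq | hpq
    · nlinarith [h8.1, mul_nonneg p1 (sub_nonneg.2 hpq)]
    · nlinarith [h8.2, mul_nonneg p2 (sub_nonneg.2 hpq)]
  refine ContinuousLinearMap.opNorm_le_bound _ (Real.sqrt_nonneg _) fun x => ?_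
  refine le_of_sq_le_sq ?_ (by positivity)
  rw [mul_pow, Real.sq_sqrt (norm_nonneg _), ← b.sum_sq_norm_inner_right x,
    ← b.sum_sq_norm_inner_right (D x), Finset.mul_sum]
  refine Finset.sum_le_sum fun i _ => ?_
  have h9 : inner 𝕜 (b i) (D x) = (c i : 𝕜) * inner 𝕜 (b i) x := by
    rw [← (show inner 𝕜 (D (b i)) x = inner 𝕜 (b i) (D x) from hsym (b i) x), hDb,
      inner_smul_left]
    simp
  rw [h9, norm_mul, mul_pow, RCLike.norm_ofReal, sq_abs]
  exact mul_le_mul_of_nonneg_right (hc i) (by positivity)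

open Classical in
/-- The positive square root of a positive operator. -/
noncomputable def opSqrt (T : W →L[𝕜] W) : W →L[𝕜] W :=
  if hT : T.IsPositive then (exists_isPositive_mul_self hT).choose else 0

theorem isPositive_opSqrt {T : W →L[𝕜] W} (hT : T.IsPositive) : (opSqrt T).IsPositive := by
  rw [opSqrt, dif_pos hT]
  exact (exists_isPositive_mul_self hT).choose_spec.1

theorem opSqrt_mul_self {T : W →L[𝕜] W} (hT : T.IsPositive) : opSqrt T * opSqrt T = T := by
  rw [opSqrt, dif_pos hT]
  exact (exists_isPositive_mul_self hT).choose_spec.2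

theorem eq_opSqrt {S : W →L[𝕜] W} (hS : S.IsPositive) {T : W →L[𝕜] W} (hST : S * S = T)
    (hT : T.IsPositive) : S = opSqrt T := by
  have h := norm_sub_le_sqrt_of_isPositive hS (isPositive_opSqrt hT)
  rw [opSqrt_mul_self hT, hST, sub_self, norm_zero, Real.sqrt_zero] at h
  exact sub_eq_zero.1 (norm_le_zero_iff.1 h)

theorem continuous_opSqrt {Y : Type*} [TopologicalSpace Y] {M : Y → W →L[𝕜] W}
    (hM : Continuous M) (hpos : ∀ y, (M y).IsPositive) : Continuous fun y => opSqrt (M y) := by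
  rw [continuous_iff_continuousAt]
  intro y
  rw [ContinuousAt, tendsto_iff_norm_sub_tendsto_zero]
  have h1 : Filter.Tendsto (fun z => √‖M z - M y‖) (𝓝 y) (𝓝 0) := by
    have : Continuous fun z => √‖M z - M y‖ := (hM.sub continuous_const).norm.sqrt
    simpa using this.tendsto y
  refine squeeze_zero (fun _ => norm_nonneg _) (fun z => ?_) h1
  have h2 :=
    norm_sub_le_sqrt_of_isPositive (isPositive_opSqrt (hpos z)) (isPositive_opSqrt (hpos y))
  rwa [opSqrt_mul_self (hpos z), opSqrt_mul_self (hpos y)] at h2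

end OperatorSqrt

/-- `N` is a norm on the topological vector space `W`, continuous for the given topology. -/
structure IsContinuousNorm (𝕜 : Type*) {W : Type*} [RCLike 𝕜] [AddCommGroup W] [Module 𝕜 W]
    [TopologicalSpace W] (N : W → ℝ) : Prop where
  continuous : Continuous N
  add_le : ∀ u v, N (u + v) ≤ N u + N v
  map_smul : ∀ (c : 𝕜) u, N (c • u) = ‖c‖ * N u
  pos : ∀ u, u ≠ 0 → 0 < N u

/-! ### Norms on `W` and integrability against `exp (-t N²)` -/

section GaussianMoment

variable {𝕜 W : Type*} [RCLike 𝕜] [NormedAddCommGroup W] [InnerProductSpace 𝕜 W]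

namespace IsContinuousNorm

variable {N : W → ℝ}

theorem map_zero (hN : IsContinuousNorm 𝕜 N) : N 0 = 0 := by
  simpa using hN.map_smul 0 0

theorem nonneg (hN : IsContinuousNorm 𝕜 N) (u : W) : 0 ≤ N u := by
  rcases eq_or_ne u 0 with rfl | hu
  · exact hN.map_zero.ge
  · exact (hN.pos u hu).le

variable [InnerProductSpace ℝ W]

theorem exists_lt_sphere [FiniteDimensional ℝ W] (hN : IsContinuousNorm 𝕜 N) :
    ∃ c, 0 < c ∧ ∀ u ∈ Metric.sphere (0 : W) 1, c < N u := by
  have := FiniteDimensional.proper ℝ W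
  obtain ⟨c, hc, h⟩ := (isCompact_sphere (0 : W) 1).exists_forall_le' hN.continuous.continuousOn
    (a := 0) (fun u hu => hN.pos u (by rintro rfl; simp at hu))
  exact ⟨c / 2, by linarith, fun u hu => by linarith [h u hu]⟩

variable [IsScalarTower ℝ 𝕜 W]

theorem map_real_smul (hN : IsContinuousNorm 𝕜 N) (r : ℝ) (u : W) : N (r • u) = |r| * N u := by
  rw [RCLike.real_smul_eq_coe_smul (K := 𝕜), hN.map_smul, RCLike.norm_ofReal]

theorem lower_bound_of_sphere (hN : IsContinuousNorm 𝕜 N) {c : ℝ}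
    (hc : ∀ u ∈ Metric.sphere (0 : W) 1, c ≤ N u) (u : W) : c * ‖u‖ ≤ N u := by
  rcases eq_or_ne u 0 with rfl | hu
  · simp [hN.map_zero]
  · have h0 : 0 < ‖u‖ := norm_pos_iff.2 hu
    have h1 := hc (‖u‖⁻¹ • u) (by simp [norm_smul, h0.ne'])
    rw [hN.map_real_smul, abs_of_pos (inv_pos.2 h0), ← div_eq_inv_mul, le_div_iff₀ h0] at h1
    exact h1

variable [FiniteDimensional ℝ W]

theorem exists_upper_bound (hN : IsContinuousNorm 𝕜 N) : ∃ C, 0 ≤ C ∧ ∀ u, N u ≤ C * ‖u‖ := by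
  have := FiniteDimensional.proper ℝ W
  obtain ⟨C, hC⟩ := (isCompact_sphere (0 : W) 1).exists_bound_of_continuousOn
    hN.continuous.continuousOn
  refine ⟨max C 0, le_max_right _ _, fun u => ?_⟩
  rcases eq_or_ne u 0 with rfl | hu
  · simp [hN.map_zero]
  · have h0 : 0 < ‖u‖ := norm_pos_iff.2 hu
    have h1 := hC (‖u‖⁻¹ • u) (by simp [norm_smul, h0.ne'])
    rw [hN.map_real_smul, abs_of_pos (inv_pos.2 h0), ← div_eq_inv_mul, Real.norm_eq_abs] at h1
    have h2 := ((le_abs_self _).trans h1).trans (le_max_left C 0)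
    rwa [div_le_iff₀ h0] at h2

end IsContinuousNorm

variable [InnerProductSpace ℝ W] [FiniteDimensional ℝ W] [MeasurableSpace W] [BorelSpace W]

theorem integrable_one_add_sq_mul_exp {c : ℝ} (hc : 0 < c) :
    Integrable fun u : W => (1 + ‖u‖ ^ 2) * Real.exp (-c * ‖u‖ ^ 2) := by
  -- Half of the exponent is kept for integrability, the other half absorbs the polynomial factor.
  have h1 : Integrable fun u : W => Real.exp (-(c / 2) * ‖u‖ ^ 2) := by
    have h := (GaussianFourier.integrable_cexp_neg_mul_sq_norm_add (V := W)
      (b := ((c / 2 : ℝ) : ℂ)) (by rw [Complex.ofReal_re]; positivity) 0 0).re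
    refine h.congr (Filter.Eventually.of_forall fun u => ?_)
    have h2 : -((c / 2 : ℝ) : ℂ) * (‖u‖ : ℂ) ^ 2 + 0 * (inner ℝ (0 : W) u : ℂ) =
        ((-(c / 2) * ‖u‖ ^ 2 : ℝ) : ℂ) := by push_cast; ring
    simp only [h2]
    exact Complex.exp_ofReal_re _
  refine (h1.const_mul (1 + 2 / c)).mono' (by fun_prop) (Filter.Eventually.of_forall fun u => ?_)
  have h3 : Real.exp (-c * ‖u‖ ^ 2) =
      Real.exp (-(c / 2) * ‖u‖ ^ 2) * Real.exp (-(c / 2 * ‖u‖ ^ 2)) := by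
    rw [← Real.exp_add]; congr 1; ring
  have h4 : Real.exp (-(c / 2 * ‖u‖ ^ 2)) ≤ 1 := Real.exp_le_one_iff.2 (by
    have : 0 ≤ c / 2 * ‖u‖ ^ 2 := by positivity
    linarith)
  have h5 : ‖u‖ ^ 2 * Real.exp (-(c / 2 * ‖u‖ ^ 2)) ≤ 2 / c := by
    rw [Real.exp_neg, ← div_eq_mul_inv, div_le_iff₀ (Real.exp_pos _)]
    have h6 := Real.add_one_le_exp (c / 2 * ‖u‖ ^ 2)
    calc ‖u‖ ^ 2 = 2 / c * (c / 2 * ‖u‖ ^ 2) := by field_simp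
      _ ≤ _ := by gcongr; linarith
  rw [Real.norm_of_nonneg (by positivity), h3]
  have h7 := Real.exp_pos (-(c / 2) * ‖u‖ ^ 2)
  calc _ = Real.exp (-(c / 2) * ‖u‖ ^ 2) * (Real.exp (-(c / 2 * ‖u‖ ^ 2)) +
        ‖u‖ ^ 2 * Real.exp (-(c / 2 * ‖u‖ ^ 2))) := by ring
    _ ≤ Real.exp (-(c / 2) * ‖u‖ ^ 2) * (1 + 2 / c) := by gcongr
    _ = _ := by ring

theorem integrable_exp_smul [IsScalarTower ℝ 𝕜 W] {N : W → ℝ} (hN : IsContinuousNorm 𝕜 N)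
    {t : ℝ} (ht : 0 < t) {F : Type*} [NormedAddCommGroup F] [NormedSpace ℝ F] {f : W → F}
    (hf : Continuous f) {A : ℝ} (hA : ∀ u, ‖f u‖ ≤ A * (1 + ‖u‖ ^ 2)) :
    Integrable fun u => Real.exp (-t * N u ^ 2) • f u := by
  have := FiniteDimensional.proper ℝ W
  obtain ⟨c, hc, hcN⟩ := hN.exists_lt_sphere
  have hlow := hN.lower_bound_of_sphere fun u hu => (hcN u hu).le
  have hNc := hN.continuous
  refine ((integrable_one_add_sq_mul_exp (W := W) (c := t * c ^ 2) (by positivity)).const_mul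
    A).mono' (by
      have : Continuous fun u => Real.exp (-t * N u ^ 2) • f u := by fun_prop
      exact this.aestronglyMeasurable) (Filter.Eventually.of_forall fun u => ?_)
  rw [norm_smul, Real.norm_of_nonneg (Real.exp_pos _).le]
  have h1 : Real.exp (-t * N u ^ 2) ≤ Real.exp (-(t * c ^ 2) * ‖u‖ ^ 2) := by
    apply Real.exp_le_exp.2
    have h2 : (c * ‖u‖) ^ 2 ≤ N u ^ 2 := pow_le_pow_left₀ (by positivity) (hlow u) 2
    nlinarith
  calc _ ≤ Real.exp (-(t * c ^ 2) * ‖u‖ ^ 2) * (A * (1 + ‖u‖ ^ 2)) := by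
        gcongr; exact hA u
    _ = _ := by ring

variable (𝕜) in
/-- The second moment of the probability density proportional to `exp (-N²)`. -/
noncomputable def gaussianMoment [IsScalarTower ℝ 𝕜 W] (N : W → ℝ) : W →L[𝕜] W :=
  (∫ u : W, Real.exp (-1 * N u ^ 2))⁻¹ • ∫ u : W, Real.exp (-1 * N u ^ 2) • rankOne 𝕜 u u

end GaussianMoment

/-! ### The Gaussian moment and its two-sided comparison with `N` -/

section GaussianMoment

variable {𝕜 W : Type*} [RCLike 𝕜] [NormedAddCommGroup W] [InnerProductSpace 𝕜 W]

theorem continuous_rankOne_self : Continuous fun u : W => rankOne 𝕜 u u :=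
  (ContinuousLinearMap.smulRightL 𝕜 W W).continuous₂.comp
    ((innerSL 𝕜).continuous.prodMk continuous_id)

variable [InnerProductSpace ℝ W] [IsScalarTower ℝ 𝕜 W] [FiniteDimensional ℝ W] [MeasurableSpace W]
  [BorelSpace W] {N : W → ℝ}

theorem integrable_exp (hN : IsContinuousNorm 𝕜 N) {t : ℝ} (ht : 0 < t) :
    Integrable fun u => Real.exp (-t * N u ^ 2) := by
  have := integrable_exp_smul hN ht (f := fun _ => (1 : ℝ)) continuous_const (A := 1)
    (fun u => by rw [norm_one]; nlinarith [sq_nonneg ‖u‖])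
  simpa using this

theorem integral_exp_neg_sq_pos (hN : IsContinuousNorm 𝕜 N) {t : ℝ} (ht : 0 < t) :
    0 < ∫ u, Real.exp (-t * N u ^ 2) :=
  _root_.MeasureTheory.integral_exp_pos (integrable_exp hN ht)

theorem integral_exp_smul_scale (hN : IsContinuousNorm 𝕜 N) (t : ℝ) {r : ℝ} (hr : 0 ≤ r) :
    ∫ u, Real.exp (-(t * r ^ 2) * N u ^ 2) =
      (r ^ Module.finrank ℝ W)⁻¹ * ∫ u, Real.exp (-t * N u ^ 2) := by
  have h := Measure.integral_comp_smul_of_nonneg (volume : Measure W)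
    (fun u => Real.exp (-t * N u ^ 2)) r (hR := hr)
  rw [smul_eq_mul] at h
  rw [← h]
  congr 1
  ext u
  rw [hN.map_real_smul, mul_pow, sq_abs]
  congr 1
  ring

theorem integrable_exp_smul_rankOne (hN : IsContinuousNorm 𝕜 N) :
    Integrable fun u : W => Real.exp (-1 * N u ^ 2) • rankOne 𝕜 u u :=
  integrable_exp_smul hN one_pos continuous_rankOne_self (A := 1)
    (fun u => by rw [norm_rankOne]; nlinarith)

theorem integrable_exp_mul_inner (hN : IsContinuousNorm 𝕜 N) {t : ℝ} (ht : 0 < t) (w ξ : W) :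
    Integrable fun u => Real.exp (-t * N u ^ 2) * ‖inner 𝕜 (u + w) ξ‖ ^ 2 := by
  refine integrable_exp_smul hN ht (f := fun u => ‖inner 𝕜 (u + w) ξ‖ ^ 2) (by fun_prop)
    (A := (2 + 2 * ‖w‖ ^ 2) * ‖ξ‖ ^ 2) fun u => ?_
  rw [Real.norm_of_nonneg (by positivity)]
  have h1 : ‖inner 𝕜 (u + w) ξ‖ ≤ (‖u‖ + ‖w‖) * ‖ξ‖ :=
    (norm_inner_le_norm _ _).trans (by gcongr; exact norm_add_le _ _)
  calc ‖inner 𝕜 (u + w) ξ‖ ^ 2 ≤ ((‖u‖ + ‖w‖) * ‖ξ‖) ^ 2 := by gcongr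
    _ = (‖u‖ + ‖w‖) ^ 2 * ‖ξ‖ ^ 2 := by ring
    _ ≤ ((2 + 2 * ‖w‖ ^ 2) * (1 + ‖u‖ ^ 2)) * ‖ξ‖ ^ 2 := by
        gcongr
        nlinarith [sq_nonneg (‖u‖ - ‖w‖), mul_nonneg (sq_nonneg ‖w‖) (sq_nonneg ‖u‖)]
    _ = _ := by ring

theorem gaussianMoment_apply (hN : IsContinuousNorm 𝕜 N) (ξ : W) :
    gaussianMoment 𝕜 N ξ = (∫ u : W, Real.exp (-1 * N u ^ 2))⁻¹ •
      ∫ u : W, Real.exp (-1 * N u ^ 2) • inner 𝕜 u ξ • u := by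
  have h := (ContinuousLinearMap.apply 𝕜 W ξ).integral_comp_comm (integrable_exp_smul_rankOne hN)
  rw [gaussianMoment, smul_apply]
  congr 1
  exact h.symm

theorem integrable_exp_smul_inner_smul (hN : IsContinuousNorm 𝕜 N) (ξ : W) :
    Integrable fun u : W => Real.exp (-1 * N u ^ 2) • inner 𝕜 u ξ • u :=
  integrable_exp_smul hN one_pos (f := fun u : W => inner 𝕜 u ξ • u) (by fun_prop) (A := ‖ξ‖)
    fun u => by
      rw [norm_smul]
      have := norm_inner_le_norm (𝕜 := 𝕜) u ξ
      nlinarith [norm_nonneg u, norm_nonneg ξ, mul_le_mul_of_nonneg_right this (norm_nonneg u)]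

theorem inner_gaussianMoment' (hN : IsContinuousNorm 𝕜 N) (η ξ : W) :
    inner 𝕜 η (gaussianMoment 𝕜 N ξ) = ((∫ u : W, Real.exp (-1 * N u ^ 2) : ℝ) : 𝕜)⁻¹ *
      ∫ u : W, ((Real.exp (-1 * N u ^ 2) : ℝ) : 𝕜) * (inner 𝕜 u ξ * inner 𝕜 η u) := by
  have h := integral_inner (𝕜 := 𝕜) (integrable_exp_smul_inner_smul hN ξ) η
  rw [gaussianMoment_apply hN, RCLike.real_smul_eq_coe_smul (K := 𝕜), inner_smul_right, ← h,
    RCLike.ofReal_inv]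
  simp only [RCLike.real_smul_eq_coe_smul (K := 𝕜), inner_smul_right]

theorem inner_gaussianMoment (hN : IsContinuousNorm 𝕜 N) (ξ : W) :
    inner 𝕜 ξ (gaussianMoment 𝕜 N ξ) = (((∫ u : W, Real.exp (-1 * N u ^ 2))⁻¹ *
      ∫ u : W, Real.exp (-1 * N u ^ 2) * ‖inner 𝕜 u ξ‖ ^ 2 : ℝ) : 𝕜) := by
  rw [inner_gaussianMoment' hN, RCLike.ofReal_mul, RCLike.ofReal_inv]
  congr 1
  rw [← integral_ofReal]
  refine integral_congr_ae (Filter.Eventually.of_forall fun u => ?_)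
  simp only
  rw [← inner_conj_symm ξ u, RCLike.mul_conj]
  push_cast
  ring

theorem isPositive_gaussianMoment (hN : IsContinuousNorm 𝕜 N) :
    (gaussianMoment 𝕜 N).IsPositive := by
  refine (ContinuousLinearMap.isPositive_iff _).2 ⟨fun v w => ?_, fun v => ?_⟩
  · simp only [ContinuousLinearMap.coe_coe]
    rw [← inner_conj_symm, inner_gaussianMoment' hN, inner_gaussianMoment' hN, map_mul,
      ← integral_conj]
    simp [mul_comm]
  · rw [← inner_conj_symm, inner_gaussianMoment hN, RCLike.conj_ofReal, RCLike.ofReal_nonneg]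
    have := integral_exp_neg_sq_pos hN one_pos
    have h2 : 0 ≤ ∫ u : W, Real.exp (-1 * N u ^ 2) * ‖inner 𝕜 u v‖ ^ 2 :=
      integral_nonneg fun u => by positivity
    positivity

/-- The quadratic form of the Gaussian moment bounds the dual norm. -/
theorem sq_norm_inner_le (hN : IsContinuousNorm 𝕜 N) (w ξ : W) :
    ‖inner 𝕜 w ξ‖ ^ 2 ≤ 4 * Real.exp 2 * √2 ^ Module.finrank ℝ W * N w ^ 2 *
      RCLike.re (inner 𝕜 ξ (gaussianMoment 𝕜 N ξ)) := by
  set Z := ∫ u : W, Real.exp (-1 * N u ^ 2) with hZ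
  have hZ0 : 0 < Z := integral_exp_neg_sq_pos hN one_pos
  set κ : ℝ := √2 ^ Module.finrank ℝ W
  have hκ : 0 < κ := by positivity
  rw [inner_gaussianMoment hN, RCLike.ofReal_re, ← hZ]
  set Q := ∫ u : W, Real.exp (-1 * N u ^ 2) * ‖inner 𝕜 u ξ‖ ^ 2 with hQ
  -- By homogeneity `N w ≤ 1` may be assumed. Write `w = (u + w) - u` and average over `u` with
  -- weight `exp (-2 N²)`, of total mass `κ⁻¹ Z`. The shifted term is compared with `Q` through `N
  -- (u + w)² ≤ 2 N(u)² + 2`, which costs the factor `exp 2`.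
  have key : ∀ w, N w ≤ 1 → ‖inner 𝕜 w ξ‖ ^ 2 ≤ 4 * Real.exp 2 * κ * (Z⁻¹ * Q) := by
    intro w hw
    have h2 : ∫ u, Real.exp (-2 * N u ^ 2) = κ⁻¹ * Z := by
      rw [hZ, ← integral_exp_smul_scale hN 1 (Real.sqrt_nonneg 2)]
      simp
    have i2 := integrable_exp_mul_inner (𝕜 := 𝕜) hN two_pos w ξ
    have i1 := integrable_exp_mul_inner (𝕜 := 𝕜) hN one_pos 0 ξ
    have i2' := integrable_exp_mul_inner (𝕜 := 𝕜) hN two_pos 0 ξ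
    simp only [add_zero] at i1 i2'
    have hA : Real.exp (-2) * ∫ u, Real.exp (-2 * N u ^ 2) * ‖inner 𝕜 (u + w) ξ‖ ^ 2 ≤ Q := by
      rw [hQ, ← integral_add_right_eq_self (fun u => Real.exp (-1 * N u ^ 2) * ‖inner 𝕜 u ξ‖ ^ 2) w,
        ← integral_const_mul]
      refine integral_mono (i2.const_mul _) (i1.comp_add_right w) fun u => ?_
      simp only
      rw [← mul_assoc, ← Real.exp_add]
      gcongr
      have h3 := hN.add_le u w
      have h4 := hN.nonneg (u + w)
      have h5 := hN.nonneg u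
      have h6 := hN.nonneg w
      nlinarith [sq_nonneg (N u - N w), pow_le_pow_left₀ h4 h3 2]
    have hB : Real.exp (-2) * ∫ u, Real.exp (-2 * N u ^ 2) * ‖inner 𝕜 u ξ‖ ^ 2 ≤ Q := by
      rw [hQ, ← integral_const_mul]
      refine integral_mono (i2'.const_mul _) i1 fun u => ?_
      simp only
      rw [← mul_assoc, ← Real.exp_add]
      gcongr
      nlinarith [sq_nonneg (N u)]
    have hC : κ⁻¹ * Z * ‖inner 𝕜 w ξ‖ ^ 2 ≤
        2 * (∫ u, Real.exp (-2 * N u ^ 2) * ‖inner 𝕜 (u + w) ξ‖ ^ 2) +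
        2 * ∫ u, Real.exp (-2 * N u ^ 2) * ‖inner 𝕜 u ξ‖ ^ 2 := by
      rw [← h2, ← integral_mul_const, ← integral_const_mul, ← integral_const_mul,
        ← integral_add (i2.const_mul _) (i2'.const_mul _)]
      refine integral_mono ((integrable_exp hN two_pos).mul_const _)
        ((i2.const_mul _).add (i2'.const_mul _)) fun u => ?_
      simp only
      have h7 : ‖inner 𝕜 w ξ‖ ≤ ‖inner 𝕜 (u + w) ξ‖ + ‖inner 𝕜 u ξ‖ := by
        have : inner 𝕜 w ξ = inner 𝕜 (u + w) ξ - inner 𝕜 u ξ := by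
          rw [inner_add_left]; ring
        rw [this]
        exact norm_sub_le _ _
      have h8 : ‖inner 𝕜 w ξ‖ ^ 2 ≤ 2 * ‖inner 𝕜 (u + w) ξ‖ ^ 2 + 2 * ‖inner 𝕜 u ξ‖ ^ 2 := by
        nlinarith [sq_nonneg (‖inner 𝕜 (u + w) ξ‖ - ‖inner 𝕜 u ξ‖),
          pow_le_pow_left₀ (norm_nonneg _) h7 2]
      have h9 := Real.exp_pos (-2 * N u ^ 2)
      nlinarith [mul_le_mul_of_nonneg_left h8 h9.le]
    have he : Real.exp 2 * Real.exp (-2) = 1 := by rw [← Real.exp_add]; simp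
    have hD : κ⁻¹ * Z * ‖inner 𝕜 w ξ‖ ^ 2 ≤ 4 * Real.exp 2 * Q := by
      have h10 : 0 < Real.exp 2 := Real.exp_pos 2
      have hA' := mul_le_mul_of_nonneg_left hA h10.le
      have hB' := mul_le_mul_of_nonneg_left hB h10.le
      rw [← mul_assoc, he, one_mul] at hA' hB'
      linarith
    calc ‖inner 𝕜 w ξ‖ ^ 2 = κ * Z⁻¹ * (κ⁻¹ * Z * ‖inner 𝕜 w ξ‖ ^ 2) := by field_simp
      _ ≤ κ * Z⁻¹ * (4 * Real.exp 2 * Q) := by gcongr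
      _ = _ := by ring
  rcases eq_or_ne w 0 with rfl | hw
  · simp [hN.map_zero]
  · have h0 := hN.pos w hw
    have h1 := key ((N w)⁻¹ • w) (by
      rw [hN.map_real_smul, abs_of_pos (inv_pos.2 h0), inv_mul_cancel₀ h0.ne'])
    rw [RCLike.real_smul_eq_coe_smul (K := 𝕜), inner_smul_left, norm_mul, mul_pow,
      RCLike.norm_conj, RCLike.norm_ofReal, sq_abs, inv_pow, ← div_eq_inv_mul,
      div_le_iff₀ (by positivity)] at h1
    linarith

omit [MeasurableSpace W] [BorelSpace W] in
theorem exists_linear_le_eq (hN : IsContinuousNorm 𝕜 N) (z : W) :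
    ∃ ℓ : W →L[ℝ] ℝ, ℓ z = N z ∧ ∀ u, ℓ u ≤ N u := by
  rcases eq_or_ne z 0 with rfl | hz
  · exact ⟨0, by simp [hN.map_zero], fun u => hN.nonneg u⟩
  obtain ⟨g, hg, hgN⟩ := exists_extension_of_le_sublinear
    (LinearPMap.mkSpanSingleton (K := ℝ) z (N z) hz) N
    (fun c hc x => by rw [hN.map_real_smul, abs_of_pos hc]) hN.add_le (by
      rintro ⟨x, hx⟩
      obtain ⟨c, rfl⟩ := Submodule.mem_span_singleton.1 hx
      refine (LinearPMap.mkSpanSingleton'_apply z (N z) _ c hx).le.trans ?_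
      rw [hN.map_real_smul]
      exact mul_le_mul_of_nonneg_right (le_abs_self c) (hN.nonneg z))
  refine ⟨g.toContinuousLinearMap, ?_, hgN⟩
  have h := hg ⟨z, Submodule.mem_span_singleton_self z⟩
  rwa [LinearPMap.mkSpanSingleton_apply] at h

/-- Evaluate a norming functional of the vector `M ξ` inside the integral: `N (M ξ)` is at most the
mean of `|⟨u, ξ⟩| N u`. Cauchy–Schwarz bounds this by the means of `|⟨u, ξ⟩|²`, which is `⟨ξ, M ξ⟩`,
and of `N²`, which is at most `κ`. -/
theorem sq_gaussianMoment_le (hN : IsContinuousNorm 𝕜 N) (ξ : W) :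
    N (gaussianMoment 𝕜 N ξ) ^ 2 ≤ √2 ^ Module.finrank ℝ W *
      RCLike.re (inner 𝕜 ξ (gaussianMoment 𝕜 N ξ)) := by
  obtain ⟨ℓ, hℓ, hℓN⟩ := exists_linear_le_eq hN (gaussianMoment 𝕜 N ξ)
  obtain ⟨C, hC0, hC⟩ := hN.exists_upper_bound
  have hNc := hN.continuous
  set n := N (gaussianMoment 𝕜 N ξ)
  set Z := ∫ u : W, Real.exp (-1 * N u ^ 2) with hZ
  have hZ0 : 0 < Z := integral_exp_neg_sq_pos hN one_pos
  set κ : ℝ := √2 ^ Module.finrank ℝ W with hκd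
  have hκ : 0 < κ := by positivity
  rw [inner_gaussianMoment hN, RCLike.ofReal_re, ← hZ]
  set Q := ∫ u : W, Real.exp (-1 * N u ^ 2) * ‖inner 𝕜 u ξ‖ ^ 2 with hQ
  have iQ := integrable_exp_mul_inner (𝕜 := 𝕜) hN one_pos 0 ξ
  simp only [add_zero] at iQ
  have iS : Integrable fun u => Real.exp (-1 * N u ^ 2) * N u ^ 2 :=
    integrable_exp_smul hN one_pos (f := fun u => N u ^ 2) (by fun_prop) (A := C ^ 2) fun u => by
      rw [Real.norm_of_nonneg (by positivity)]
      have := pow_le_pow_left₀ (hN.nonneg u) (hC u) 2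
      nlinarith [sq_nonneg C]
  have hhalf : ∫ u, Real.exp (-(1 / 2) * N u ^ 2) = κ * Z := by
    rw [← mul_inv_cancel_left₀ hκ.ne' (∫ u, Real.exp (-(1 / 2) * N u ^ 2)), hκd,
      ← integral_exp_smul_scale hN (1 / 2) (Real.sqrt_nonneg 2)]
    simp [hZ]
  have hS : ∫ u, Real.exp (-1 * N u ^ 2) * N u ^ 2 ≤ κ * Z := by
    rw [← hhalf]
    refine integral_mono iS (integrable_exp hN one_half_pos) fun u => ?_
    simp only
    have h1 : Real.exp (-1 * N u ^ 2) =
        Real.exp (-(1 / 2) * N u ^ 2) * Real.exp (-(1 / 2 * N u ^ 2)) := by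
      rw [← Real.exp_add]; congr 1; ring
    -- With `t = N(u)²`: `exp (t / 2) ≥ (1 + t / 4)² = (1 - t / 4)² + t ≥ t`.
    have h2 : N u ^ 2 ≤ Real.exp (1 / 2 * N u ^ 2) := by
      have h3 := Real.add_one_le_exp (N u ^ 2 / 4)
      have h4 : Real.exp (1 / 2 * N u ^ 2) = Real.exp (N u ^ 2 / 4) ^ 2 := by
        rw [← Real.exp_nat_mul]; congr 1; push_cast; ring
      rw [h4]
      nlinarith [sq_nonneg (1 - N u ^ 2 / 4), sq_nonneg (N u),
        pow_le_pow_left₀ (by positivity) h3 2]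
    rw [h1, mul_assoc]
    refine mul_le_of_le_one_right (Real.exp_pos _).le ?_
    rw [Real.exp_neg, inv_mul_le_iff₀ (Real.exp_pos _), mul_one]
    exact h2
  -- Cauchy–Schwarz in its arithmetic-geometric form with a free parameter; `s = n / κ` is used
  -- below, which is why `n = 0` is treated apart.
  have key : ∀ s : ℝ, 0 < s → 2 * n ≤ s * κ + s⁻¹ * (Z⁻¹ * Q) := by
    intro s hs
    have h1 : n = Z⁻¹ * ∫ u : W, Real.exp (-1 * N u ^ 2) * ℓ (inner 𝕜 u ξ • u) := by
      rw [← hℓ, gaussianMoment_apply hN, map_smul, smul_eq_mul,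
        ← ℓ.integral_comp_comm (integrable_exp_smul_inner_smul hN ξ)]
      simp only [map_smul, smul_eq_mul, hZ]
    have iL : Integrable fun u => Real.exp (-1 * N u ^ 2) * ℓ (inner 𝕜 u ξ • u) := by
      have := ℓ.integrable_comp (integrable_exp_smul_inner_smul hN ξ)
      simpa using this
    have h2 : 2 * ∫ u : W, Real.exp (-1 * N u ^ 2) * ℓ (inner 𝕜 u ξ • u) ≤
        s * (∫ u, Real.exp (-1 * N u ^ 2) * N u ^ 2) + s⁻¹ * Q := by
      rw [hQ, ← integral_const_mul, ← integral_const_mul, ← integral_const_mul,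
        ← integral_add (iS.const_mul _) (iQ.const_mul _)]
      refine integral_mono (iL.const_mul _) ((iS.const_mul _).add (iQ.const_mul _)) fun u => ?_
      simp only
      have h3 : ℓ (inner 𝕜 u ξ • u) ≤ ‖inner 𝕜 u ξ‖ * N u :=
        (hℓN _).trans (hN.map_smul _ _).le
      have h4 : 2 * (‖inner 𝕜 u ξ‖ * N u) ≤ s * N u ^ 2 + s⁻¹ * ‖inner 𝕜 u ξ‖ ^ 2 := by
        have h5 : 0 ≤ s⁻¹ * (s * N u - ‖inner 𝕜 u ξ‖) ^ 2 := by positivity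
        have h6 : s⁻¹ * (s * N u - ‖inner 𝕜 u ξ‖) ^ 2 =
            s * N u ^ 2 + s⁻¹ * ‖inner 𝕜 u ξ‖ ^ 2 - 2 * (‖inner 𝕜 u ξ‖ * N u) := by
          field_simp; ring
        linarith
      have h7 := Real.exp_pos (-1 * N u ^ 2)
      calc _ = Real.exp (-1 * N u ^ 2) * (2 * ℓ (inner 𝕜 u ξ • u)) := by ring
        _ ≤ Real.exp (-1 * N u ^ 2) * (s * N u ^ 2 + s⁻¹ * ‖inner 𝕜 u ξ‖ ^ 2) := by
          gcongr; linarith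
        _ = _ := by ring
    calc 2 * n = Z⁻¹ * (2 * ∫ u : W, Real.exp (-1 * N u ^ 2) * ℓ (inner 𝕜 u ξ • u)) := by
          rw [h1]; ring
      _ ≤ Z⁻¹ * (s * (κ * Z) + s⁻¹ * Q) := by
          gcongr
          exact h2.trans (by gcongr)
      _ = _ := by field_simp
  rcases (hN.nonneg (gaussianMoment 𝕜 N ξ)).eq_or_lt with h0 | h0
  · have hn : n = 0 := h0.symm
    rw [hn, sq, mul_zero]
    have : 0 ≤ Q := integral_nonneg fun u => by positivity
    positivity
  · have hn : 0 < n := h0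
    have h1 := key (n / κ) (by positivity)
    have h2 : n / κ * κ = n := by field_simp
    have h3 : n ≤ (n / κ)⁻¹ * (Z⁻¹ * Q) := by linarith
    rw [inv_div, div_mul_eq_mul_div, le_div_iff₀ hn] at h3
    rwa [sq]

end GaussianMoment

/-! ### Equivariant continuous normalization of norms -/

section Normalization

variable {𝕜 W : Type*} [RCLike 𝕜] [NormedAddCommGroup W] [InnerProductSpace 𝕜 W]

section Real

variable [InnerProductSpace ℝ W] [IsScalarTower ℝ 𝕜 W] [FiniteDimensional ℝ W] [MeasurableSpace W]
  [BorelSpace W] {N : W → ℝ}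

theorem gaussianMoment_equivariant (g : W ≃ₗᵢ[𝕜] W) {N' : W → ℝ} (hN : IsContinuousNorm 𝕜 N)
    (hN' : IsContinuousNorm 𝕜 N') (h : ∀ u, N' (g u) = N u) (ξ : W) :
    gaussianMoment 𝕜 N' (g ξ) = g (gaussianMoment 𝕜 N ξ) := by
  let gR : W ≃ₗᵢ[ℝ] W := ⟨g.toLinearEquiv.restrictScalars ℝ, g.norm_map⟩
  have hg : ∀ u, gR u = g u := fun _ => rfl
  have hZ : ∫ u : W, Real.exp (-1 * N' u ^ 2) = ∫ u : W, Real.exp (-1 * N u ^ 2) := by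
    rw [← (gR.measurePreserving).integral_comp gR.toHomeomorph.measurableEmbedding]
    simp only [hg, h]
  rw [gaussianMoment_apply hN', gaussianMoment_apply hN, hZ, ← hg (_ • _), map_smul]
  congr 1
  refine ((gR.measurePreserving).integral_comp gR.toHomeomorph.measurableEmbedding _).symm.trans ?_
  simp only [hg, h, LinearIsometryEquiv.inner_map_map]
  have h1 := (gR.toContinuousLinearEquiv : W →L[ℝ] W).integral_comp_comm
    (integrable_exp_smul_inner_smul hN ξ)
  refine Eq.trans (integral_congr_ae (Filter.Eventually.of_forall fun u => ?_)) h1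
  change Real.exp (-1 * N u ^ 2) • inner 𝕜 u ξ • g u =
    gR (Real.exp (-1 * N u ^ 2) • inner 𝕜 u ξ • u)
  rw [map_smul, hg, g.map_smul]

/-- Dominated convergence needs a first countable parameter space, which `Y` need not be. So the
family is factored through the norms in `C(W, ℝ)` with the compact-open topology. There a lower
bound `c` on the unit sphere is an open condition, and it provides a local Gaussian majorant. -/
theorem continuous_integral_exp_smul {Y : Type*} [TopologicalSpace Y] {N : Y → W → ℝ}
    (hNc : Continuous fun q : Y × W => N q.1 q.2) (hN : ∀ y, IsContinuousNorm 𝕜 (N y))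
    {F : Type*} [NormedAddCommGroup F] [NormedSpace ℝ F] {f : W → F}
    (hf : Continuous f) {A : ℝ} (hA : ∀ u, ‖f u‖ ≤ A * (1 + ‖u‖ ^ 2)) :
    Continuous fun y => ∫ u, Real.exp (-1 * N y u ^ 2) • f u := by
  have := FiniteDimensional.proper ℝ W
  let P : Set C(W, ℝ) := {p | IsContinuousNorm 𝕜 p}
  suffices h : Continuous fun p : P => ∫ u, Real.exp (-1 * p.1 u ^ 2) • f u by
    let c : C(Y, C(W, ℝ)) := ContinuousMap.curry ⟨fun q : Y × W => N q.1 q.2, hNc⟩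
    have hc : Continuous fun y => (⟨c y, hN y⟩ : P) := c.continuous.subtype_mk _
    exact h.comp hc
  have : FirstCountableTopology C(W, ℝ) := UniformSpace.firstCountableTopology _
  have : FirstCountableTopology P := Topology.IsInducing.subtypeVal.firstCountableTopology
  rw [continuous_iff_continuousAt]
  intro p₀
  obtain ⟨c, hc, hcN⟩ := p₀.2.exists_lt_sphere
  refine continuousAt_of_dominated
    (bound := fun u => A * ((1 + ‖u‖ ^ 2) * Real.exp (-(c ^ 2) * ‖u‖ ^ 2)))
    (Filter.Eventually.of_forall fun p => ?_) ?_
    ((integrable_one_add_sq_mul_exp (by positivity)).const_mul A)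
    (Filter.Eventually.of_forall fun u => ?_)
  · have hp := p.1.continuous
    have : Continuous fun u => Real.exp (-1 * p.1 u ^ 2) • f u := by fun_prop
    exact this.aestronglyMeasurable
  · have h1 : ∀ᶠ p : P in 𝓝 p₀, Set.MapsTo p.1 (Metric.sphere (0 : W) 1) (Set.Ioi c) := by
      refine ((ContinuousMap.isOpen_setOfPred_mapsTo (isCompact_sphere (0 : W) 1)
        isOpen_Ioi).preimage continuous_subtype_val).mem_nhds ?_
      exact fun u hu => hcN u hu
    filter_upwards [h1] with p hp
    refine Filter.Eventually.of_forall fun u => ?_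
    have h2 := p.2.lower_bound_of_sphere (fun u hu => (hp hu).le) u
    rw [norm_smul, Real.norm_of_nonneg (Real.exp_pos _).le]
    have h3 : Real.exp (-1 * p.1 u ^ 2) ≤ Real.exp (-(c ^ 2) * ‖u‖ ^ 2) := by
      apply Real.exp_le_exp.2
      have h4 : (c * ‖u‖) ^ 2 ≤ p.1 u ^ 2 := pow_le_pow_left₀ (by positivity) h2 2
      linarith
    calc _ ≤ Real.exp (-(c ^ 2) * ‖u‖ ^ 2) * (A * (1 + ‖u‖ ^ 2)) := by
          gcongr; exact hA u
      _ = _ := by ring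
  · have h1 : Continuous fun p : P => p.1 u :=
      (ContinuousEvalConst.continuous_eval_const u).comp continuous_subtype_val
    have : Continuous fun p : P => Real.exp (-1 * p.1 u ^ 2) • f u := by fun_prop
    exact this.continuousAt

theorem continuous_gaussianMoment {Y : Type*} [TopologicalSpace Y] {N : Y → W → ℝ}
    (hNc : Continuous fun q : Y × W => N q.1 q.2) (hN : ∀ y, IsContinuousNorm 𝕜 (N y)) :
    Continuous fun y => gaussianMoment 𝕜 (N y) := by
  have h1 := continuous_integral_exp_smul hNc hN (f := fun _ => (1 : ℝ)) continuous_const (A := 1)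
    (fun u => by rw [norm_one]; nlinarith [sq_nonneg ‖u‖])
  simp only [smul_eq_mul, mul_one] at h1
  exact (h1.inv₀ fun y => (integral_exp_neg_sq_pos (hN y) one_pos).ne').smul
    (continuous_integral_exp_smul hNc hN continuous_rankOne_self (A := 1)
      (fun u => by rw [norm_rankOne]; nlinarith))

variable [FiniteDimensional 𝕜 W]

theorem sq_norm_opSqrt_gaussianMoment (hN : IsContinuousNorm 𝕜 N) (ξ : W) :
    ‖opSqrt (gaussianMoment 𝕜 N) ξ‖ ^ 2 = RCLike.re (inner 𝕜 ξ (gaussianMoment 𝕜 N ξ)) := by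
  have hM := isPositive_gaussianMoment hN
  conv_rhs => rw [← opSqrt_mul_self hM, mul_apply_eq_comp,
    ← (isPositive_opSqrt hM).inner_left_eq_inner_right]
  rw [inner_self_eq_norm_sq]

theorem isUnit_opSqrt_gaussianMoment (hN : IsContinuousNorm 𝕜 N) :
    IsUnit (opSqrt (gaussianMoment 𝕜 N)) := by
  rw [ContinuousLinearMap.isUnit_iff_isUnit_toLinearMap, LinearMap.isUnit_iff_ker_eq_bot,
    LinearMap.ker_eq_bot']
  intro ξ hξ
  have h1 := sq_norm_opSqrt_gaussianMoment hN ξ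
  have h2 := sq_norm_inner_le hN ξ ξ
  rw [← h1, show opSqrt (gaussianMoment 𝕜 N) ξ = 0 from hξ] at h2
  simpa using h2

/-- The conjugate of the root by `g` is positive and squares to the moment of `N'`, so uniqueness of
the positive root applies. -/
theorem opSqrt_gaussianMoment_equivariant (g : W ≃ₗᵢ[𝕜] W) {N' : W → ℝ}
    (hN : IsContinuousNorm 𝕜 N) (hN' : IsContinuousNorm 𝕜 N') (h : ∀ u, N' (g u) = N u) (ξ : W) :
    opSqrt (gaussianMoment 𝕜 N') (g ξ) = g (opSqrt (gaussianMoment 𝕜 N) ξ) := by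
  let c : W →L[𝕜] W := g.toContinuousLinearEquiv
  let c' : W →L[𝕜] W := g.symm.toContinuousLinearEquiv
  have hM := isPositive_gaussianMoment hN
  have hS := isPositive_opSqrt hM
  have hcc : ∀ v w, inner 𝕜 (g v) w = inner 𝕜 v (g.symm w) := fun v w => by
    rw [← g.inner_map_map v, g.apply_symm_apply]
  have hpos : (c * opSqrt (gaussianMoment 𝕜 N) * c').IsPositive := by
    refine (ContinuousLinearMap.isPositive_iff _).2 ⟨fun v w => ?_, fun v => ?_⟩
    · change inner 𝕜 (g (opSqrt (gaussianMoment 𝕜 N) (g.symm v))) w =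
        inner 𝕜 v (g (opSqrt (gaussianMoment 𝕜 N) (g.symm w)))
      rw [hcc, hS.inner_left_eq_inner_right, ← g.inner_map_map, g.apply_symm_apply]
    · have h1 := hS.inner_nonneg_left (g.symm v)
      rwa [← hcc] at h1
  have heq := eq_opSqrt hpos (T := gaussianMoment 𝕜 N') (by
    ext v
    change g (opSqrt (gaussianMoment 𝕜 N) (g.symm (g (opSqrt (gaussianMoment 𝕜 N) (g.symm v))))) = _
    rw [g.symm_apply_apply, ← mul_apply_eq_comp, opSqrt_mul_self hM,
      ← gaussianMoment_equivariant g hN hN' h, g.apply_symm_apply]) (isPositive_gaussianMoment hN')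
  rw [← heq]
  change g (opSqrt (gaussianMoment 𝕜 N) (g.symm (g ξ))) = _
  rw [g.symm_apply_apply]

end Real

variable (𝕜 W) in
/-- Continuous norms on a finite-dimensional Hilbert space can be turned into the given one, up to a
uniform constant, by linear automorphisms that depend continuously and equivariantly on the norm. -/
theorem exists_equivariant_normalization [FiniteDimensional 𝕜 W] :
    ∃ (S T : (W → ℝ) → W →L[𝕜] W) (C : ℝ), 0 < C ∧
      (∀ N, IsContinuousNorm 𝕜 N → (∀ w, S N (T N w) = w) ∧
        ∀ w, ‖T N w‖ ≤ C * N w ∧ N w ≤ C * ‖T N w‖) ∧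
      (∀ (g : W ≃ₗᵢ[𝕜] W) (N N' : W → ℝ), IsContinuousNorm 𝕜 N → IsContinuousNorm 𝕜 N' →
        (∀ w, N' (g w) = N w) → ∀ w, T N' (g w) = g (T N w)) ∧
      ∀ {Y : Type v} [TopologicalSpace Y] (N : Y → W → ℝ),
        (Continuous fun q : Y × W => N q.1 q.2) → (∀ y, IsContinuousNorm 𝕜 (N y)) →
        (Continuous fun y => S (N y)) ∧ Continuous fun y => T (N y) := by
  let _ : InnerProductSpace ℝ W := InnerProductSpace.rclikeToReal 𝕜 W
  have _ : IsScalarTower ℝ 𝕜 W := RestrictScalars.isScalarTower ℝ 𝕜 W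
  have _ : FiniteDimensional ℝ W := Module.Finite.trans 𝕜 W
  borelize W
  let S : (W → ℝ) → W →L[𝕜] W := fun N => opSqrt (gaussianMoment 𝕜 N)
  let T : (W → ℝ) → W →L[𝕜] W := fun N => Ring.inverse (S N)
  have hST : ∀ N, IsContinuousNorm 𝕜 N → ∀ w, S N (T N w) = w := fun N hN w => by
    rw [← mul_apply_eq_comp, Ring.mul_inverse_cancel _ (isUnit_opSqrt_gaussianMoment hN)]
    rfl
  have hTS : ∀ N, IsContinuousNorm 𝕜 N → ∀ w, T N (S N w) = w := fun N hN w => by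
    rw [← mul_apply_eq_comp, Ring.inverse_mul_cancel _ (isUnit_opSqrt_gaussianMoment hN)]
    rfl
  have hSS : ∀ N, IsContinuousNorm 𝕜 N → ∀ w, S N (S N w) = gaussianMoment 𝕜 N w :=
    fun N hN w => by
      rw [← mul_apply_eq_comp, opSqrt_mul_self (isPositive_gaussianMoment hN)]
  set κ : ℝ := √2 ^ Module.finrank ℝ W
  have hκ : 0 < κ := by positivity
  set C₁ : ℝ := 4 * Real.exp 2 * κ
  have hC₁ : 0 < C₁ := by positivity
  have hupper : ∀ N, IsContinuousNorm 𝕜 N → ∀ w, ‖T N w‖ ^ 2 ≤ C₁ * N w ^ 2 ∧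
      N w ^ 2 ≤ κ * ‖T N w‖ ^ 2 := by
    intro N hN w
    -- Here `ξ = M⁻¹ w`, so `‖T w‖² = ⟨ξ, M ξ⟩ = ⟨ξ, w⟩`. The dual bound then reads `‖T w‖⁴ ≤ C₁
    -- N(w)² ‖T w‖²`, and the other bound is that for `N (M ξ)`.
    set ξ := T N (T N w)
    have hξ : S N ξ = T N w := hST N hN _
    have hMξ : gaussianMoment 𝕜 N ξ = w := by rw [← hSS N hN, hξ, hST N hN]
    have hq : ‖T N w‖ ^ 2 = RCLike.re (inner 𝕜 ξ (gaussianMoment 𝕜 N ξ)) := by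
      rw [← hξ]; exact sq_norm_opSqrt_gaussianMoment hN ξ
    constructor
    · have h1 := sq_norm_inner_le hN w ξ
      rw [← hq] at h1
      have h2 : ‖T N w‖ ^ 2 ≤ ‖inner 𝕜 w ξ‖ := by
        rw [hq, hMξ, norm_inner_symm]
        exact RCLike.re_le_norm _
      have h3 := pow_le_pow_left₀ (by positivity) h2 2
      rcases (sq_nonneg ‖T N w‖).eq_or_lt with h0 | h0
      · rw [← h0]; positivity
      · refine le_of_mul_le_mul_right ?_ h0
        rw [← sq]
        exact h3.trans h1
    · have h1 := sq_gaussianMoment_le hN ξ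
      rwa [← hq, hMξ] at h1
  refine ⟨S, T, max (√C₁) (√κ), lt_max_of_lt_left (Real.sqrt_pos.2 hC₁),
    fun N hN => ⟨hST N hN, fun w => ?_⟩, fun g N N' hN hN' h w => ?_, fun {Y} _ N hNc hN => ?_⟩
  · obtain ⟨h1, h2⟩ := hupper N hN w
    constructor
    · refine le_trans ?_ (mul_le_mul_of_nonneg_right (le_max_left _ _) (hN.nonneg w))
      refine le_of_sq_le_sq ?_ (mul_nonneg (Real.sqrt_nonneg _) (hN.nonneg w))
      rwa [mul_pow, Real.sq_sqrt hC₁.le]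
    · refine le_trans ?_ (mul_le_mul_of_nonneg_right (le_max_right _ _) (norm_nonneg _))
      refine le_of_sq_le_sq ?_ (by positivity)
      rwa [mul_pow, Real.sq_sqrt hκ.le]
  · have h1 := opSqrt_gaussianMoment_equivariant g hN hN' h (T N w)
    rw [← hTS N' hN' (g (T N w))]
    congr 1
    exact (h1.trans (congrArg g (hST N hN w))).symm
  · have hS : Continuous fun y => S (N y) :=
      continuous_opSqrt (continuous_gaussianMoment hNc hN) fun y => isPositive_gaussianMoment (hN y)
    refine ⟨hS, continuous_iff_continuousAt.2 fun y => ?_⟩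
    obtain ⟨u, hu⟩ := isUnit_opSqrt_gaussianMoment (hN y)
    have h1 := NormedRing.inverse_continuousAt u
    rw [hu] at h1
    exact ContinuousAt.comp (f := fun y => S (N y)) h1 hS.continuousAt

end Normalization

/-! ### Suprema over a compact space -/

section Supremum

variable {G Y : Type*} [TopologicalSpace G] [CompactSpace G] [TopologicalSpace Y]

theorem continuous_iSup_of_compactSpace {f : Y → G → ℝ}
    (hf : Continuous fun q : Y × G => f q.1 q.2) : Continuous fun y => ⨆ g, f y g := by
  have h := (isCompact_univ (X := G)).continuous_sSup (f := f) hf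
  simpa only [Set.image_univ, sSup_range] using h

theorem bddAbove_range_of_compactSpace {f : G → ℝ} (hf : Continuous f) :
    BddAbove (Set.range f) :=
  isCompact_range hf |>.bddAbove

end Supremum

/-! ### Making the norm of `E` invariant -/

section InvariantNorm

/-- The norm as a function on the total space. -/
def totNorm {X : Type*} {E : X → Type*} [∀ x, NormedAddCommGroup (E x)] (e : Tot E) : ℝ := ‖e.snd‖

/-- The supremum of the norm of a Banach bundle over the orbits of the action. -/
noncomputable def invariantNorm (G : Type*) {X : Type*} {E : X → Type*}
    [∀ x, NormedAddCommGroup (E x)] [SMul G (Tot E)] (e : Tot E) : ℝ :=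
  ⨆ g : G, totNorm (g • e)

theorem invariantNorm_smul {G X : Type*} {E : X → Type*} [Group G]
    [∀ x, NormedAddCommGroup (E x)] [MulAction G (Tot E)] (g : G) (e : Tot E) :
    invariantNorm G (g • e) = invariantNorm G e := by
  simp only [invariantNorm, smul_smul]
  exact (Equiv.mulRight g).iSup_comp (g := fun h : G => totNorm (h • e))

variable {𝕜 G X : Type*} [RCLike 𝕜] [Group G] [TopologicalSpace G]
  [TopologicalSpace X] [MulAction G X] {E : X → Type*} [∀ x, NormedAddCommGroup (E x)]
  [∀ x, NormedSpace 𝕜 (E x)] [TopologicalSpace (Tot E)] [MulAction G (Tot E)]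

variable (hE : IsContinuousBanachBundle 𝕜 G E)
include hE

theorem invariantNorm_const_smul (x : X) (c : 𝕜) (v : E x) :
    invariantNorm G (Tot.mk x (c • v)) = ‖c‖ * invariantNorm G (Tot.mk x v) := by
  rw [invariantNorm, invariantNorm, Real.mul_iSup_of_nonneg (norm_nonneg c)]
  congr 1
  ext g
  obtain ⟨L, hL⟩ := hE.act_linear g x
  rw [hL, hL, map_smul]
  exact norm_smul c (L v)

variable [CompactSpace G]

theorem bddAbove_norm_smul (e : Tot E) : BddAbove (Set.range fun g : G => totNorm (g • e)) :=
  bddAbove_range_of_compactSpace (hE.continuous_norm.comp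
    (hE.continuous_act.comp (continuous_id.prodMk continuous_const)))

theorem continuous_invariantNorm : Continuous (invariantNorm G (E := E)) :=
  continuous_iSup_of_compactSpace (f := fun (e : Tot E) (g : G) => totNorm (g • e))
    (hE.continuous_norm.comp (hE.continuous_act.comp continuous_swap))

theorem norm_le_invariantNorm (e : Tot E) : totNorm e ≤ invariantNorm G e := by
  have h := le_ciSup (bddAbove_norm_smul hE e) 1
  rw [one_smul] at h
  exact h

theorem invariantNorm_add_le (x : X) (u v : E x) :
    invariantNorm G (Tot.mk x (u + v)) ≤
      invariantNorm G (Tot.mk x u) + invariantNorm G (Tot.mk x v) := by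
  refine ciSup_le fun g => ?_
  obtain ⟨L, hL⟩ := hE.act_linear g x
  have h1 := le_ciSup (bddAbove_norm_smul hE (Tot.mk x u)) g
  have h2 := le_ciSup (bddAbove_norm_smul hE (Tot.mk x v)) g
  simp only [hL] at h1 h2
  rw [hL, map_add]
  exact (norm_add_le (L u) (L v)).trans (add_le_add h1 h2)

end InvariantNorm

/-! ### Invariant bump functions on `Fᶜ` -/

section Bump

variable {G X : Type*} [Group G] [TopologicalSpace G] [CompactSpace G] [TopologicalSpace X]
  [MulAction G X] [ContinuousSMul G X]

/-- A finite cover of a normal open set `Fᶜ` by invariant open sets admits subordinate invariant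
bump functions, one of which is equal to `1` at each given point. -/
theorem exists_invariant_bump {F : Set X} (hF : IsClosed F) (hFinv : Invariant G Fᶜ)
    (hnormal : NormalSpace (Fᶜ : Set X)) {m : ℕ} {U : Fin m → Set X} (hU : ⋃ i, U i = Fᶜ)
    (hUo : ∀ i, IsOpen (U i)) (hUi : ∀ i, Invariant G (U i)) :
    ∃ (ψ : Fin m → X → ℝ) (D : Fin m → Set X), (∀ i, ContinuousOn (ψ i) Fᶜ) ∧
      (∀ i (g : G), ∀ x ∈ Fᶜ, ψ i (g • x) = ψ i x) ∧ (∀ i x, 0 ≤ ψ i x ∧ ψ i x ≤ 1) ∧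
      (∀ x ∈ Fᶜ, ∃ i, ψ i x = 1) ∧ (∀ i, IsOpen (D i)) ∧ (∀ i, Fᶜ ⊆ U i ∪ D i) ∧
      ∀ i, ∀ x ∈ D i, ψ i x = 0 := by
  classical
  let Y : Set X := Fᶜ
  have hY : IsOpen Y := hF.isOpen_compl
  let act : G × Y → Y := fun q => ⟨q.1 • q.2.1, hFinv q.1 _ q.2.2⟩
  have hact : Continuous act :=
    (continuous_fst.smul (continuous_subtype_val.comp continuous_snd)).subtype_mk _
  obtain ⟨v, hv, hvc, hvU⟩ := exists_iUnion_eq_closed_subset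
    (u := fun i => ((↑) ⁻¹' U i : Set Y)) (fun i => (hUo i).preimage continuous_subtype_val)
    (fun x => Set.toFinite _) (by
      rw [← Set.preimage_iUnion, hU]
      exact Subtype.coe_preimage_self _)
  have hw : ∀ i, ∃ w : Set Y, IsOpen w ∧ v i ⊆ w ∧ closure w ⊆ (↑) ⁻¹' U i := fun i =>
    normal_exists_closure_subset (hvc i) ((hUo i).preimage continuous_subtype_val) (hvU i)
  choose w hwo hvw hwU using hw
  have hf : ∀ i, ∃ f : C(Y, ℝ), Set.EqOn f 0 (w i)ᶜ ∧ Set.EqOn f 1 (v i) ∧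
      ∀ x, f x ∈ Set.Icc (0 : ℝ) 1 := fun i =>
    exists_continuous_zero_one_of_isClosed (hwo i).isClosed_compl (hvc i)
      (Set.disjoint_left.2 fun x hx hx' => hx (hvw i hx'))
  choose f hf0 hf1 hf01 using hf
  -- The supremum over `G` makes the function invariant; compactness of `G` keeps it continuous.
  let ψ : Fin m → Y → ℝ := fun i y => ⨆ g, f i (act (g, y))
  have hbdd : ∀ i y, BddAbove (Set.range fun g => f i (act (g, y))) := fun i y =>
    ⟨1, by rintro _ ⟨g, rfl⟩; exact (hf01 i _).2⟩
  have hψc : ∀ i, Continuous (ψ i) := fun i =>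
    continuous_iSup_of_compactSpace ((f i).continuous.comp (hact.comp continuous_swap))
  have hψG : ∀ i (g : G) (y : Y), ψ i (act (g, y)) = ψ i y := fun i g y => by
    have h1 : ∀ h : G, act (h, act (g, y)) = act (h * g, y) := fun h =>
      Subtype.ext (smul_smul h g y.1)
    simp only [ψ, h1]
    exact (Equiv.mulRight g).iSup_comp (g := fun h : G => f i (act (h, y)))
  -- The `G`-saturation of `closure (w i)`. It is closed because projection along the compact `G` is
  -- a closed map, and stays inside the invariant set `U i`; its complement in `Y` serves as `D i`.
  let C : Fin m → Set Y := fun i => Prod.snd '' (act ⁻¹' closure (w i))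
  have hC : ∀ i, IsClosed (C i) := fun i =>
    isClosedMap_snd_of_compactSpace _ (isClosed_closure.preimage hact)
  have hCU : ∀ i, ∀ y ∈ C i, y.1 ∈ U i := by
    rintro i _ ⟨⟨g, y⟩, hy, rfl⟩
    have h1 := hUi i g⁻¹ _ (hwU i hy)
    simpa [act] using h1
  have hψC : ∀ i, ∀ y ∉ C i, ψ i y = 0 := by
    intro i y hy
    have h1 : ∀ g, f i (act (g, y)) = 0 := fun g =>
      hf0 i fun hg => hy ⟨(g, y), subset_closure hg, rfl⟩
    simp [ψ, h1]
  refine ⟨fun i x => if hx : x ∈ Y then ψ i ⟨x, hx⟩ else 0, fun i => (↑) '' (C i)ᶜ, fun i => ?_,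
    fun i g x hx => ?_, fun i x => ?_, fun x hx => ?_, fun i => ?_, fun i x hx => ?_, fun i => ?_⟩
  · rw [continuousOn_iff_continuous_domRestrict]
    refine (hψc i).congr fun y => ?_
    have hy : y.1 ∈ Y := y.2
    simp only [Set.domRestrict_apply, dif_pos hy]
  · have hgx : g • x ∈ Y := hFinv g x hx
    have hx' : x ∈ Y := hx
    simp only [dif_pos hgx, dif_pos hx']
    exact hψG i g ⟨x, hx⟩
  · by_cases hx : x ∈ Y
    · simp only [dif_pos hx]
      have h1 := le_ciSup (hbdd i ⟨x, hx⟩) 1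
      exact ⟨(hf01 i _).1.trans h1, ciSup_le fun g => (hf01 i _).2⟩
    · simp [hx]
  · have h1 : (⟨x, hx⟩ : Y) ∈ ⋃ i, v i := by rw [hv]; trivial
    obtain ⟨i, hi⟩ := Set.mem_iUnion.1 h1
    have hx' : x ∈ Y := hx
    refine ⟨i, ?_⟩
    simp only [dif_pos hx']
    have h2 := le_ciSup (hbdd i ⟨x, hx⟩) 1
    have h3 : act (1, ⟨x, hx⟩) = ⟨x, hx⟩ := Subtype.ext (one_smul G x)
    simp only [h3, hf1 i hi, Pi.one_apply] at h2
    exact le_antisymm (ciSup_le fun g => (hf01 i _).2) h2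
  · exact hY.isOpenMap_subtype_val _ (hC i).isOpen_compl
  · by_cases h1 : (⟨x, hx⟩ : Y) ∈ C i
    · exact Or.inl (hCU i _ h1)
    · exact Or.inr ⟨⟨x, hx⟩, h1, rfl⟩
  · rintro _ ⟨y, hy, rfl⟩
    simp only [Subtype.coe_prop, dif_pos]
    exact hψC i y hy

end Bump

/-! ### Retractions with bounded distortion -/

section NormalizedRetract

variable {𝕜 : Type w} {G : Type*} {X : Type v} [RCLike 𝕜] [Group G] [TopologicalSpace G]
  [CompactSpace G] [TopologicalSpace X] [MulAction G X] {E : X → Type*}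
  [∀ x, NormedAddCommGroup (E x)] [∀ x, NormedSpace 𝕜 (E x)] [TopologicalSpace (Tot E)]
  [MulAction G (Tot E)]

/-- The retraction of `U × W` onto `E` can be chosen so that the inclusion distorts the norm by a
bounded factor. -/
theorem IsRetractOver.exists_normalized (hE : IsContinuousBanachBundle 𝕜 G E) {U : Set X}
    {W : Type*} [NormedAddCommGroup W] [InnerProductSpace 𝕜 W] [FiniteDimensional 𝕜 W]
    {σ : G →* (W ≃ₗᵢ[𝕜] W)} {a : ∀ x, E x →ₗ[𝕜] W} {b : ∀ x, W →ₗ[𝕜] E x}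
    (h : IsRetractOver U σ a b) :
    ∃ (a' : ∀ x, E x →ₗ[𝕜] W) (b' : ∀ x, W →ₗ[𝕜] E x) (C : ℝ), 0 < C ∧
      (∀ x ∈ U, ∀ v, b' x (a' x v) = v) ∧
      ContinuousOn (fun e : Tot E => a' e.proj e.snd) {e | e.proj ∈ U} ∧
      ContinuousOn (fun p : X × W => Tot.mk p.1 (b' p.1 p.2)) (U ×ˢ Set.univ) ∧
      (∀ (g : G) (e : Tot E), e.proj ∈ U → a' _ (g • e).snd = σ g (a' _ e.snd)) ∧
      ∀ e : Tot E, e.proj ∈ U → ‖a' _ e.snd‖ ≤ C * invariantNorm G e ∧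
        invariantNorm G e ≤ C * ‖a' _ e.snd‖ := by
  obtain ⟨S, T, C, hC, hST, hTG, hcont⟩ := exists_equivariant_normalization.{v} 𝕜 W
  let α : Tot E → W := fun e => a e.proj e.snd
  -- An extension of the invariant norm from the image of `E x` to all of `W`: the second summand
  -- vanishes on that image and makes `N x` definite on the kernel of the retraction.
  let N : X → W → ℝ := fun x w =>
    invariantNorm G (Tot.mk x (b x w)) + ‖w - a x (b x w)‖
  have hα : ContinuousOn α {e | e.proj ∈ U} := h.continuousOn_incl
  have hβc : Continuous fun q : U × W => Tot.mk q.1.1 (b q.1.1 q.2) :=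
    h.continuousOn_retr.comp_continuous
      ((continuous_subtype_val.comp continuous_fst).prodMk continuous_snd)
      fun q => ⟨q.1.2, trivial⟩
  have hNc : Continuous fun q : U × W => N q.1.1 q.2 := by
    have h1 : Continuous fun q : U × W => α (Tot.mk q.1.1 (b q.1.1 q.2)) :=
      hα.comp_continuous hβc fun q => q.1.2
    exact ((continuous_invariantNorm hE).comp hβc).add (continuous_snd.sub h1).norm
  have hN : ∀ x ∈ U, IsContinuousNorm 𝕜 (N x) := by
    intro x hx
    refine ⟨hNc.comp ((continuous_const (y := (⟨x, hx⟩ : U))).prodMk continuous_id), ?_, ?_, ?_⟩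
    · intro u v
      have h1 := invariantNorm_add_le hE x (b x u) (b x v)
      have h2 : u + v - a x (b x (u + v)) = (u - a x (b x u)) + (v - a x (b x v)) := by
        rw [map_add, map_add]; abel
      have h3 := norm_add_le (u - a x (b x u)) (v - a x (b x v))
      simp only [N]
      rw [h2, map_add]
      linarith
    · intro c u
      simp only [N]
      rw [map_smul, invariantNorm_const_smul hE, map_smul, ← smul_sub, norm_smul, mul_add]
    · intro u hu
      have h1 := norm_le_invariantNorm hE (Tot.mk x (b x u))
      have h2 : 0 ≤ totNorm (Tot.mk x (b x u)) := norm_nonneg (b x u)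
      rcases h2.eq_or_lt with h3 | h3
      · have h4 : b x u = 0 := norm_eq_zero.1 h3.symm
        have h5 : 0 < ‖u‖ := norm_pos_iff.2 hu
        simp only [N]
        rw [h4, map_zero, sub_zero]
        rw [h4] at h1 h3
        linarith
      · have := norm_nonneg (u - a x (b x u))
        simp only [N]
        linarith
  have hproj : ∀ (g : G) (e : Tot E), (g • e).proj = g • e.proj := hE.toIsLinearBundle.proj_smul
  have hNG : ∀ (g : G), ∀ x ∈ U, ∀ w, N (g • x) (σ g w) = N x w := by
    intro g x hx w
    have h1 := h.retr_smul g x hx w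
    have h2 : a (g • x) (b (g • x) (σ g w)) = σ g (a x (b x w)) :=
      (congrArg α h1).trans (h.incl_smul g (Tot.mk x (b x w)) hx)
    simp only [N]
    rw [h1, invariantNorm_smul, h2, ← map_sub, LinearIsometryEquiv.norm_map]
  obtain ⟨hSc, hTc⟩ := hcont (fun x : U => N x.1) hNc fun x => hN x.1 x.2
  refine ⟨fun x => (T (N x) : W →ₗ[𝕜] W) ∘ₗ a x, fun x => b x ∘ₗ (S (N x) : W →ₗ[𝕜] W), C, hC,
    fun x hx v => ?_, ?_, ?_, fun g e he => ?_, fun e he => ?_⟩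
  · simp only [LinearMap.comp_apply, ContinuousLinearMap.coe_coe]
    rw [(hST _ (hN x hx)).1, h.left_inv x hx]
  · rw [continuousOn_iff_continuous_domRestrict] at hα ⊢
    have h1 : Continuous fun e : {e : Tot E | e.proj ∈ U} => (⟨e.1.proj, e.2⟩ : U) :=
      (hE.continuous_proj.comp continuous_subtype_val).subtype_mk _
    exact (hTc.comp h1).clm_apply hα
  · rw [continuousOn_iff_continuous_domRestrict]
    have h1 : Continuous fun q : (U ×ˢ (Set.univ : Set W) : Set (X × W)) => (⟨q.1.1, q.2.1⟩ : U) :=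
      (continuous_fst.comp continuous_subtype_val).subtype_mk _
    exact hβc.comp (h1.prodMk ((hSc.comp h1).clm_apply
      (continuous_snd.comp continuous_subtype_val)))
  · change T (N (g • e).proj) (α (g • e)) = σ g (T (N e.proj) (α e))
    have h1 : α (g • e) = σ g (α e) := h.incl_smul g e he
    rw [h1, hproj]
    exact hTG (σ g) _ _ (hN _ he) (hN _ (h.invariant g _ he)) (hNG g _ he) _
  · have h1 : N e.proj (a e.proj e.snd) = invariantNorm G e := by
      simp only [N]
      rw [h.left_inv _ he, sub_self, norm_zero, add_zero]
    have h2 := (hST _ (hN _ he)).2 (a e.proj e.snd)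
    rw [h1] at h2
    exact h2

end NormalizedRetract

/-! ### The product bundle of a representation -/

section TrivialBundle

variable {𝕜 : Type w} {G : Type*} {X : Type v} [RCLike 𝕜] [Group G] [TopologicalSpace G]
  [TopologicalSpace X] [MulAction G X] [ContinuousSMul G X] {W : Type w} [NormedAddCommGroup W]
  [InnerProductSpace 𝕜 W] [FiniteDimensional 𝕜 W]

/-- The product topology on `X × W`, seen as the total space of a trivial family. -/
@[reducible] def trivialTopology (X W : Type*) [TopologicalSpace X] [TopologicalSpace W] :
    TopologicalSpace (Tot fun _ : X => W) :=
  .induced (fun e => (e.proj, e.snd)) inferInstance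

/-- The diagonal action on `X × W`, seen as the total space of a trivial family. -/
@[reducible] def trivialAction (X : Type*) [MulAction G X] (σ : G →* (W ≃ₗᵢ[𝕜] W)) :
    MulAction G (Tot fun _ : X => W) where
  smul g e := Tot.mk (g • e.proj) (σ g e.snd)
  one_smul e := by
    change Tot.mk (E := fun _ : X => W) ((1 : G) • e.proj) (σ 1 e.snd) = e
    rw [one_smul, map_one]; rfl
  mul_smul g h e := by
    change Tot.mk (E := fun _ : X => W) ((g * h) • e.proj) (σ (g * h) e.snd) =
      Tot.mk (E := fun _ : X => W) (g • h • e.proj) (σ g (σ h e.snd))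
    rw [mul_smul, map_mul]; rfl

/-- One global chart suffices, with `K = G` and `f` constant: `G ×_G W` is `W` through `[g, v] ↦ g
v`, and this map inverts the chart continuously. -/
theorem isLocallyTrivialVectorBundle_trivial (σ : G →* (W ≃ₗᵢ[𝕜] W))
    (hσ : ∀ w, Continuous fun g => σ g w) :
    letI := trivialTopology X W
    letI := trivialAction X σ
    IsLocallyTrivialVectorBundle 𝕜 G (fun _ : X => W) := by
  let _ := trivialTopology X W
  let _ := trivialAction X σ
  have hp : Continuous fun e : Tot (fun _ : X => W) => (e.proj, e.snd) := continuous_induced_dom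
  have hp1 : Continuous fun e : Tot (fun _ : X => W) => e.proj := hp.fst
  have hp2 : Continuous fun e : Tot (fun _ : X => W) => (e.snd : W) := hp.snd
  have hσ' := continuous_uncurry_unitary σ hσ
  refine ⟨⟨hp1, ?_, ?_, ?_, fun g x => ⟨(σ g).toLinearEquiv.toLinearMap, fun v => rfl⟩⟩, fun x =>
    ⟨Set.univ, trivial, isOpen_univ, fun _ _ _ => trivial, ?_⟩⟩
  · have h : Continuous fun p : TotalSpace (Unit × Unit)
        ((fun _ : X => W) ×ᵇ (fun _ : X => W)) =>
        ((⟨p.1, p.2.1⟩, ⟨p.1, p.2.2⟩) : Tot (fun _ : X => W) × Tot (fun _ : X => W)) :=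
      continuous_induced_dom
    exact continuous_induced_rng.2 ((hp1.comp h.fst).prodMk ((hp2.comp h.fst).add (hp2.comp h.snd)))
  · exact continuous_induced_rng.2 ((hp1.comp continuous_snd).prodMk
      (continuous_fst.smul (hp2.comp continuous_snd)))
  · exact continuous_induced_rng.2 ((continuous_fst.smul (hp1.comp continuous_snd)).prodMk
      (hσ'.comp (continuous_fst.prodMk (hp2.comp continuous_snd))))
  · let b : W ≃ₗ[𝕜] (Fin (Module.finrank 𝕜 W) → 𝕜) := (Module.finBasis 𝕜 W).equivFun
    have hb : Continuous b := b.toLinearMap.continuous_of_finiteDimensional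
    have hb' : Continuous b.symm := b.symm.toLinearMap.continuous_of_finiteDimensional
    let ρ : Representation 𝕜 (⊤ : Subgroup G) (Fin (Module.finrank 𝕜 W) → 𝕜) :=
      { toFun := fun k => b.toLinearMap ∘ₗ (σ k).toLinearEquiv.toLinearMap ∘ₗ b.symm.toLinearMap
        map_one' := LinearMap.ext fun v => by simp
        map_mul' := fun g h => LinearMap.ext fun v => by simp }
    have hρ : ∀ k v, ρ k v = b (σ k (b.symm v)) := fun _ _ => rfl
    have hι : ∀ (k : (⊤ : Subgroup G)) v, b.symm.toLinearMap (ρ k v) =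
        σ k (b.symm.toLinearMap v) := fun k v => b.symm_apply_apply _
    refine ⟨⊤, _, ρ, fun _ => ((1 : G) : G ⧸ (⊤ : Subgroup G)),
      fun e => LocalObject.mk ρ 1 (b e.snd), isClosed_univ, ?_, continuousOn_const,
      fun x _ => ⟨1, b, rfl, fun v => rfl⟩, fun g e _ => ?_, ?_⟩
    · exact hb.comp (hσ'.comp ((continuous_subtype_val.comp continuous_fst).prodMk
        (hb'.comp continuous_snd)))
    · change LocalObject.mk ρ 1 (b (σ g e.snd)) = LocalObject.mk ρ (g * 1) (b e.snd)
      have h := LocalObject.mk_mul (ρ := ρ) 1 ⟨g, trivial⟩ (b e.snd)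
      rw [hρ, b.symm_apply_apply] at h
      rw [← h, one_mul, mul_one]
    · let r : X × LocalObject (⊤ : Subgroup G) ρ →
          {e : Tot (fun _ : X => W) // e.proj ∈ Set.univ} :=
        fun q => ⟨Tot.mk q.1 (q.2.toRep σ b.symm.toLinearMap hι), trivial⟩
      have hr : Continuous r := by
        refine Continuous.subtype_mk (continuous_induced_rng.2 ?_) _
        exact continuous_fst.prodMk
          ((LocalObject.continuous_toRep σ b.symm.toLinearMap hι hσ).comp continuous_snd)
      refine Function.LeftInverse.isEmbedding (f := r) (fun e => ?_) hr ?_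
      · refine Subtype.ext ?_
        change Tot.mk e.1.proj (σ 1 (b.symm (b e.1.snd))) = e.1
        rw [map_one, b.symm_apply_apply]
        rfl
      · exact (hp1.comp continuous_subtype_val).prodMk (LocalObject.continuous_mk.comp
          (continuous_const.prodMk (hb.comp (hp2.comp continuous_subtype_val))))

end TrivialBundle

/-! ### Cutting off an inclusion and extending it across `F` -/

section Component

variable {𝕜 : Type w} {G : Type*} {X : Type v} [RCLike 𝕜] [Group G] [TopologicalSpace G]
  [CompactSpace G] [TopologicalSpace X] [MulAction G X] {E : X → Type*}
  [∀ x, NormedAddCommGroup (E x)] [∀ x, NormedSpace 𝕜 (E x)] [TopologicalSpace (Tot E)]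
  [MulAction G (Tot E)]

/-- A fibrewise linear, continuous, equivariant map `c` from `E` to a unitary representation, which
is a split inclusion with left inverse `r` over the open set `P`, and does not shrink the norm over
`P'` by more than a bounded factor. -/
structure IsPartialInclusion (P P' : Set X) {W : Type*} [NormedAddCommGroup W]
    [InnerProductSpace 𝕜 W] (σ : G →* (W ≃ₗᵢ[𝕜] W)) (c : ∀ x, E x →ₗ[𝕜] W)
    (r : ∀ x, W → E x) (C : ℝ) : Prop where
  isOpen : IsOpen P
  subset : P' ⊆ P
  nonneg : 0 ≤ C
  continuous : Continuous fun e : Tot E => c e.proj e.snd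
  map_smul : ∀ (g : G) (e : Tot E), c _ (g • e).snd = σ g (c _ e.snd)
  left_inv : ∀ x ∈ P, ∀ v, r x (c x v) = v
  continuousOn_left_inv : ContinuousOn (fun p : X × W => Tot.mk p.1 (r p.1 p.2)) (P ×ˢ Set.univ)
  norm_le : ∀ e : Tot E, e.proj ∈ P' → ‖e.snd‖ ≤ C * ‖c _ e.snd‖

omit [CompactSpace G] in
theorem invariantNorm_eq_zero (hE : IsContinuousBanachBundle 𝕜 G E) {e : Tot E} (he : e.snd = 0) :
    invariantNorm G e = 0 := by
  have h := invariantNorm_const_smul hE e.proj (0 : 𝕜) e.snd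
  rw [norm_zero, zero_mul, zero_smul] at h
  rwa [← he] at h

/-- Multiply the normalized inclusion by `ψ`. Away from `F` continuity is clear on `U` and on `D`.
At `F` nothing is known about `ψ` except `0 ≤ ψ ≤ 1`, but `‖c e‖` is at most a constant times the
invariant norm, which is continuous and zero there. Where `ψ ≠ 0`, dividing by `ψ` before retracting
inverts `c`. -/
theorem IsRetractOver.exists_isPartialInclusion (hE : IsContinuousBanachBundle 𝕜 G E) {F : Set X}
    (hFinv : Invariant G F) (hvanish : ∀ x ∈ F, Subsingleton (E x))
    {U : Set X} (hUF : U ⊆ Fᶜ) {W : Type*} [NormedAddCommGroup W] [InnerProductSpace 𝕜 W]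
    [FiniteDimensional 𝕜 W] {σ : G →* (W ≃ₗᵢ[𝕜] W)} {a : ∀ x, E x →ₗ[𝕜] W}
    {b : ∀ x, W →ₗ[𝕜] E x} (h : IsRetractOver U σ a b) {ψ : X → ℝ} {D : Set X}
    (hψ : ContinuousOn ψ Fᶜ) (hψG : ∀ (g : G), ∀ x ∈ Fᶜ, ψ (g • x) = ψ x)
    (hψ01 : ∀ x, 0 ≤ ψ x ∧ ψ x ≤ 1) (hD : IsOpen D) (hUD : Fᶜ ⊆ U ∪ D)
    (hψD : ∀ x ∈ D, ψ x = 0) :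
    ∃ (P : Set X) (c : ∀ x, E x →ₗ[𝕜] W) (r : ∀ x, W → E x) (C : ℝ),
      IsPartialInclusion P {x | x ∈ Fᶜ ∧ ψ x = 1} σ c r C := by
  obtain ⟨a, b, C, hC, hba, ha, hb, haG, hn⟩ := h.exists_normalized hE
  have hzero : ∀ e : Tot E, e.proj ∈ F → e.snd = 0 := fun e he =>
    (hvanish _ he).elim _ _
  have hψU : ContinuousOn ψ U := hψ.mono hUF
  let c : ∀ x, E x →ₗ[𝕜] W := fun x => (ψ x : 𝕜) • a x
  have hc : ∀ e : Tot E, c _ e.snd = (ψ e.proj : 𝕜) • a _ e.snd := fun e => rfl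
  have hcD : ∀ e : Tot E, e.proj ∈ D → c _ e.snd = 0 := fun e he => by
    rw [hc, hψD _ he, RCLike.ofReal_zero, zero_smul]
  have hbound : ∀ e : Tot E, ‖c _ e.snd‖ ≤ C * invariantNorm G e := by
    intro e
    have h0 : 0 ≤ invariantNorm G e := (norm_nonneg e.snd).trans (norm_le_invariantNorm hE e)
    by_cases he : e.proj ∈ F
    · rw [hzero e he, map_zero, norm_zero]
      positivity
    · rcases hUD he with h1 | h1
      · rw [hc, norm_smul, RCLike.norm_ofReal, abs_of_nonneg (hψ01 _).1]
        exact (mul_le_of_le_one_left (norm_nonneg _) (hψ01 _).2).trans (hn e h1).1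
      · rw [hcD e h1, norm_zero]
        positivity
  refine ⟨U ∩ ψ ⁻¹' {0}ᶜ, c, fun x w => b x ((ψ x : 𝕜)⁻¹ • w), C,
    hψU.isOpen_inter_preimage h.isOpen isOpen_compl_singleton, ?_, hC.le, ?_, ?_, ?_, ?_, ?_⟩
  · rintro x ⟨hx, hx1⟩
    refine ⟨(hUD hx).resolve_right fun hxD => ?_, ?_⟩
    · rw [hψD x hxD] at hx1
      exact zero_ne_one hx1
    · simp [hx1]
  · refine continuous_iff_continuousAt.2 fun e => ?_
    by_cases he : e.proj ∈ F
    · have h0 : invariantNorm G e = 0 := invariantNorm_eq_zero hE (hzero e he)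
      have h1 : Filter.Tendsto (fun e : Tot E => C * invariantNorm G e) (𝓝 e) (𝓝 0) := by
        have := ((continuous_invariantNorm hE).const_mul C).tendsto e
        rwa [h0, mul_zero] at this
      change Filter.Tendsto _ _ (𝓝 (c _ e.snd))
      rw [hzero e he, map_zero]
      exact squeeze_zero_norm hbound h1
    · rcases hUD he with h1 | h1
      · have h2 : {e : Tot E | e.proj ∈ U} ∈ 𝓝 e :=
          (h.isOpen.preimage hE.continuous_proj).mem_nhds h1
        have h3 : ContinuousAt (fun e : Tot E => ψ e.proj) e :=
          (hψU.continuousAt (h.isOpen.mem_nhds h1)).comp hE.continuous_proj.continuousAt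
        exact (RCLike.continuous_ofReal.continuousAt.comp h3).smul (ha.continuousAt h2)
      · have h2 : {e : Tot E | e.proj ∈ D} ∈ 𝓝 e :=
          (hD.preimage hE.continuous_proj).mem_nhds h1
        refine (continuousAt_const (y := (0 : W))).congr ?_
        filter_upwards [h2] with e' he' using (hcD e' he').symm
  · intro g e
    have hp := hE.toIsLinearBundle.proj_smul g e
    by_cases he : e.proj ∈ F
    · rw [hzero e he, hzero (g • e) (hp ▸ hFinv g _ he), map_zero, map_zero, map_zero]
    · have h1 : ψ (g • e).proj = ψ e.proj := hp ▸ hψG g _ he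
      rcases hUD he with h2 | h2
      · rw [hc, hc, haG g e h2, h1, _root_.map_smul]
      · rw [hc, hcD e h2, h1, hψD _ h2, RCLike.ofReal_zero, zero_smul, map_zero]
  · rintro x ⟨hx, hx0⟩ v
    have h1 : (ψ x : 𝕜) ≠ 0 := RCLike.ofReal_ne_zero.2 hx0
    change b x ((ψ x : 𝕜)⁻¹ • (ψ x : 𝕜) • a x v) = v
    rw [inv_smul_smul₀ h1, hba x hx]
  · have h1 : ContinuousOn (fun p : X × W => (p.1, (ψ p.1 : 𝕜)⁻¹ • p.2))
        ((U ∩ ψ ⁻¹' {0}ᶜ) ×ˢ Set.univ) := by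
      have h2 : ContinuousOn (fun p : X × W => (ψ p.1 : 𝕜)) ((U ∩ ψ ⁻¹' {0}ᶜ) ×ˢ Set.univ) :=
        RCLike.continuous_ofReal.comp_continuousOn
          (hψU.comp continuous_fst.continuousOn fun p hp => hp.1.1)
      exact continuous_fst.continuousOn.prodMk
        ((h2.inv₀ fun p hp => RCLike.ofReal_ne_zero.2 hp.1.2).smul continuous_snd.continuousOn)
    exact hb.comp h1 fun p hp => ⟨hp.1.1, trivial⟩
  · rintro e ⟨he, he1⟩
    have h1 : e.proj ∈ U := (hUD he).resolve_right fun hxD => by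
      rw [hψD _ hxD] at he1
      exact zero_ne_one he1
    rw [hc, he1, RCLike.ofReal_one, one_smul]
    exact (norm_le_invariantNorm hE e).trans (hn e h1).2

end Component

/-! ### Assembling the partial inclusions into an embedding -/

section Assembly

variable {𝕜 : Type w} {G : Type*} {X : Type v} [RCLike 𝕜] [Group G] [TopologicalSpace G]
  [TopologicalSpace X] [MulAction G X] {E : X → Type*}
  [∀ x, NormedAddCommGroup (E x)] [∀ x, NormedSpace 𝕜 (E x)] [TopologicalSpace (Tot E)]
  [MulAction G (Tot E)] {I : Type} [Fintype I] {W : I → Type w}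
  [∀ i, NormedAddCommGroup (W i)] [∀ i, InnerProductSpace 𝕜 (W i)]
  {σ : ∀ i, G →* (W i ≃ₗᵢ[𝕜] W i)} {P P' : I → Set X} {c : ∀ i x, E x →ₗ[𝕜] W i}
  {r : ∀ i x, W i → E x} {C : I → ℝ}

/-- Partial inclusions whose domains cover the set where `E` does not vanish separate the points of
`E` and induce its topology. -/
theorem isEmbedding_of_isPartialInclusion (hE : IsContinuousBanachBundle 𝕜 G E)
    (h : ∀ i, IsPartialInclusion (P i) (P' i) (σ i) (c i) (r i) (C i)) {F : Set X}
    (hvanish : ∀ x ∈ F, Subsingleton (E x)) (hcover : ∀ x ∉ F, ∃ i, x ∈ P' i) :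
    IsEmbedding fun e : Tot E => (e.proj, fun i => c i _ e.snd) := by
  have hcont : Continuous fun e : Tot E => (e.proj, fun i => c i _ e.snd) :=
    hE.continuous_proj.prodMk (continuous_pi fun i => (h i).continuous)
  have hnorm : ∀ e : Tot E, ‖e.snd‖ ≤ ∑ i, C i * ‖c i _ e.snd‖ := by
    intro e
    have hnn : ∀ i, 0 ≤ C i * ‖c i _ e.snd‖ := fun i => mul_nonneg (h i).nonneg (norm_nonneg _)
    by_cases he : e.proj ∈ F
    · rw [(hvanish _ he).elim e.snd 0, norm_zero]
      simp
    · obtain ⟨i, hi⟩ := hcover _ he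
      exact ((h i).norm_le e hi).trans
        (Finset.single_le_sum (fun i _ => hnn i) (Finset.mem_univ i))
  refine ⟨isInducing_iff_nhds.2 fun e => le_antisymm hcont.continuousAt.le_comap ?_, ?_⟩
  -- Over `F` the point is a zero vector, whose basic neighbourhoods bound the base point and the
  -- norm; `hnorm` controls the norm by the image. Off `F`, the local left inverse `R` recovers
  -- nearby points continuously from their images.
  · by_cases he : e.proj ∈ F
    · have he0 : e = Tot.mk e.proj 0 := by
        rcases e with ⟨x, v⟩
        exact congrArg (Tot.mk x) ((hvanish x he).elim v 0)
      have hbasis := hE.nhds_zero e.proj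
      rw [← he0] at hbasis
      refine hbasis.ge_iff.2 ?_
      rintro ⟨O, ε⟩ ⟨hO, heO, hε⟩
      have hs : Continuous fun q : X × ∀ i, W i => ∑ i, C i * ‖q.2 i‖ := by fun_prop
      have h0 : ∑ i, C i * ‖c i _ e.snd‖ = 0 := by
        rw [(hvanish _ he).elim e.snd 0]
        simp
      refine ⟨{q | q.1 ∈ O} ∩ {q | ∑ i, C i * ‖q.2 i‖ < ε}, Filter.inter_mem
        ((hO.preimage continuous_fst).mem_nhds heO) ((isOpen_Iio.preimage hs).mem_nhds ?_), ?_⟩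
      · change ∑ i, C i * ‖c i _ e.snd‖ < ε
        rwa [h0]
      · rintro e' ⟨h1, h2⟩
        exact ⟨h1, (hnorm e').trans_lt h2⟩
    · obtain ⟨i, hi'⟩ := hcover _ he
      have hi := (h i).subset hi'
      let R : (X × ∀ i, W i) → Tot E := fun q => Tot.mk q.1 (r i q.1 (q.2 i))
      have hR : ContinuousAt R (e.proj, fun i => c i _ e.snd) := by
        have h1 : ContinuousAt (fun p : X × W i => Tot.mk p.1 (r i p.1 p.2))
            (e.proj, c i _ e.snd) :=
          (h i).continuousOn_left_inv.continuousAt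
            (((h i).isOpen.prod isOpen_univ).mem_nhds ⟨hi, trivial⟩)
        have h2 : Continuous fun q : X × ∀ i, W i => (q.1, q.2 i) := by fun_prop
        exact h1.comp_of_eq h2.continuousAt rfl
      have hRe : ∀ e' : Tot E, e'.proj ∈ P i → R (e'.proj, fun i => c i _ e'.snd) = e' :=
        fun e' he' => congrArg (Tot.mk e'.proj) ((h i).left_inv _ he' _)
      intro s hs
      have h1 : R ⁻¹' s ∈ 𝓝 (e.proj, fun i => c i _ e.snd) := hR (by rwa [hRe e hi])
      refine ⟨R ⁻¹' s ∩ {q | q.1 ∈ P i}, Filter.inter_mem h1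
        (((h i).isOpen.preimage continuous_fst).mem_nhds hi), ?_⟩
      rintro e' ⟨h2, h3⟩
      have h4 : R (e'.proj, fun i => c i _ e'.snd) ∈ s := h2
      rwa [hRe e' h3] at h4
  · rintro ⟨x, u⟩ ⟨y, v⟩ huv
    obtain rfl : x = y := congrArg Prod.fst huv
    refine congrArg (Tot.mk x) ?_
    by_cases hx : x ∈ F
    · exact (hvanish x hx).elim u v
    · obtain ⟨i, hi⟩ := hcover x hx
      have h1 : c i x u = c i x v := congrFun (congrArg Prod.snd huv) i
      rw [← (h i).left_inv x ((h i).subset hi) u, h1, (h i).left_inv x ((h i).subset hi)]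

theorem isBundleEmbedding_of_isPartialInclusion (hE : IsContinuousBanachBundle 𝕜 G E)
    (h : ∀ i, IsPartialInclusion (P i) (P' i) (σ i) (c i) (r i) (C i)) {F : Set X}
    (hvanish : ∀ x ∈ F, Subsingleton (E x)) (hcover : ∀ x ∉ F, ∃ i, x ∈ P' i) :
    letI := trivialTopology X (PiLp 2 W)
    letI := trivialAction X (piRep σ)
    IsBundleEmbedding 𝕜 G E (fun _ : X => PiLp 2 W)
      fun x => (WithLp.linearEquiv 2 𝕜 (∀ i, W i)).symm.toLinearMap ∘ₗ
        LinearMap.pi fun i => c i x := by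
  let _ := trivialTopology X (PiLp 2 W)
  let _ := trivialAction X (piRep σ)
  refine ⟨fun g e => ?_, ?_⟩
  · refine congrArg₂ (fun (x : X) (w : PiLp 2 W) => Tot.mk (E := fun _ : X => PiLp 2 W) x w)
      (hE.toIsLinearBundle.proj_smul g e) ?_
    ext i
    exact (h i).map_smul g e
  · have hcont : Continuous fun e : Tot E => Tot.mk (E := fun _ : X => PiLp 2 W) e.proj
        (WithLp.toLp 2 fun i => c i _ e.snd) :=
      continuous_induced_rng.2 (hE.continuous_proj.prodMk
        ((PiLp.continuous_toLp 2 W).comp (continuous_pi fun i => (h i).continuous)))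
    have hq : Continuous fun e : Tot (fun _ : X => PiLp 2 W) =>
        (e.proj, (WithLp.ofLp e.snd : ∀ i, W i)) := by
      have hp : Continuous fun e : Tot (fun _ : X => PiLp 2 W) => (e.proj, e.snd) :=
        continuous_induced_dom
      exact hp.fst.prodMk ((PiLp.continuous_ofLp 2 W).comp hp.snd)
    exact IsEmbedding.of_comp hcont hq (isEmbedding_of_isPartialInclusion hE h hvanish hcover)

end Assembly

end EqBundle

/-! ### The embedding theorem -/

theorem mainTheorem9
    {𝕜 : Type w} [RCLike 𝕜]
    -- a compact Lie group
    {𝔤 : Type*} [NormedAddCommGroup 𝔤] [NormedSpace ℝ 𝔤] [FiniteDimensional ℝ 𝔤]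
    {G : Type*} [Group G] [TopologicalSpace G] [T2Space G] [CompactSpace G]
    [ChartedSpace 𝔤 G] [LieGroup 𝓘(ℝ, 𝔤) ∞ G]
    -- a Tychonoff base space with a continuous action
    {X : Type*} [TopologicalSpace X] [T35Space X] [MulAction G X] [ContinuousSMul G X]
    -- a subhomogeneous continuous equivariant Banach bundle
    (E : X → Type*) [∀ x, NormedAddCommGroup (E x)] [∀ x, NormedSpace 𝕜 (E x)]
    [TopologicalSpace (Tot E)] [MulAction G (Tot E)]
    (hE : IsContinuousBanachBundle 𝕜 G E) (hsub : IsSubhomogeneous 𝕜 E)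
    -- vanishing along the closed invariant set `F`, homogeneous of finite type off `F`
    (F : Set X) (hFclosed : IsClosed F) (hFinv : Invariant G F)
    (hvanish : ∀ x ∈ F, Subsingleton (E x))
    (hnormal : T4Space (Fᶜ : Set X))
    (hhom : IsHomogeneousOver 𝕜 E Fᶜ) (hft : IsFiniteTypeOver 𝕜 G E Fᶜ) :
    ∃ (V : X → Type w) (_ : ∀ x, AddCommGroup (V x)) (_ : ∀ x, Module 𝕜 (V x))
      (_ : TopologicalSpace (Tot V)) (_ : MulAction G (Tot V)),
      IsLocallyTrivialVectorBundle 𝕜 G V ∧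
      ∃ φ : ∀ x, E x →ₗ[𝕜] V x, IsBundleEmbedding 𝕜 G E V φ := by
  have : IsTopologicalGroup G := topologicalGroup_of_lieGroup 𝓘(ℝ, 𝔤) ∞
  obtain ⟨m, U, hU, htriv⟩ := hft
  have hFinv' : Invariant G Fᶜ := fun g x hx hgx => hx (by
    simpa only [inv_smul_smul] using hFinv g⁻¹ _ hgx)
  choose W _ _ _ σ a b hret using fun i => (htriv i).exists_isRetractOver hE.toIsLinearBundle
  obtain ⟨ψ, D, hψ, hψG, hψ01, hψ1, hD, hUD, hψD⟩ := exists_invariant_bump hFclosed hFinv'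
    hnormal.toNormalSpace hU (fun i => (hret i).isOpen) fun i => (hret i).invariant
  choose P c r C hc using fun i => (hret i).exists_isPartialInclusion hE hFinv hvanish
    (hU ▸ Set.subset_iUnion U i) (hψ i) (hψG i) (hψ01 i) (hD i) (hUD i) (hψD i)
  exact ⟨fun _ => PiLp 2 W, fun _ => inferInstance, fun _ => inferInstance,
    trivialTopology X (PiLp 2 W), trivialAction X (piRep σ),
    isLocallyTrivialVectorBundle_trivial _
      (continuous_piRep σ fun i => (hret i).continuous_rep), _,
    -- Each point off `F` has a bump function equal to `1` there, so the sets carrying the lower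
    -- norm bounds cover `Fᶜ`.
    isBundleEmbedding_of_isPartialInclusion hE hc hvanish fun x hx =>
      (hψ1 x hx).imp fun _ h => ⟨hx, h⟩⟩
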